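/- **Conventions.** Let $m\ge 2$ and $\mathcal A=\{0,1,\dots,m-1\}$. An $\mathbb N$ shift is a closed set $X\subseteq\mathcal A^{\mathbb N}$ with $\sigma(X)\subseteq X$, where $\sigma$ is the shift map; it is *hereditary* if $x\in X$ and $y_i\le x_i$ for all $i$ imply $y\in X$. Its entropy is $h(X)=\lim_n \frac1n\log|B_n(X)|$, where $B_n(X)$ is the set of $n$-blocks occurring in points of $X$. A *tree* $T$ is a rooted locally finite tree whose vertices are words over a set of generators, the root being the empty word and the parent of $g_1\cdots g_{n+1}$ being $g_1\cdots g_n$; all trees are assumed to have no leaves (every vertex has a child). $T_n$ is the set of vertices at distance $n$ from the root and $\Delta_n=T_0\cup\dots\cup T_n$. The tree is *unexpandable* if $\lim_n |T_{n+1}|/|T_n|$ exists and equals $1$. For a $d\times d$ matrix $M$ with entries in $\{0,1\}$, the *Markov–Cayley tree* of $M$ consists of all words $g_{i_1}\cdots g_{i_n}$ ($n\ge0$) with $M_{i_j,i_{j+1}}=1$ for all $1\le j<n$. The tree-shift $\mathcal T_X\subseteq \mathcal A^T$ is the set of labelled trees whose labels along every infinite ray from the root form a point of $X$; its entropy is $h(\mathcal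 T_X)=\limsup_n \log|\{t|_{\Delta_n}:t\in\mathcal T_X\}|/|\Delta_n|$. A set $S\subseteq T$ is an *independence set* of $\mathcal T_X$ if for every $u\in\mathcal A^S$ there is $t\in\mathcal T_X$ with $t_g=u_g$ for all $g\in S$. The *density* of $S$ is $d(S)=\lim_n|S\cap\Delta_n|/|\Delta_n|$ if this limit exists, and the upper density $\overline d(S)$ is the corresponding $\limsup$. **Theorem.** Let $X\subseteq\mathcal A^{\mathbb N}$ be a hereditary shift and let $T$ be an unexpandable Markov–Cayley tree without leaves. Then 1. $h(\mathcal T_X)=h(X)$. 2. If $m=2$, then $h(\mathcal T_X)>0$ if and only if $\mathcal T_X$ has an independence set whose density exists and is positive. For arbitrary $m\ge2$: if $\mathcal T_X$ has an independence set of positive upper density, then $h(\mathcal T_X)>0$; and if $h(\mathcal T_X)>\log(m-1)$, then $\mathcal T_X$ has an independence set whose density exists and is positive. Furthermore, if $X\subseteq\mathcal A^{\mathbb N}$ is any $\mathbb N$ shift (not necessarily hereditary) with $h(X)=0$ and $T$ is any unexpandable tree without leaves (not necessarily a Markov–Cayley tree), then every independence set $S$ of $\mathcal T_X$ has density zero: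 $d(S)$ exists and equals $0$. -/

import Mathlib

open Filter Topology

namespace TreeShift

/-! ### One-sided shifts -/

/-- An `ℕ`-shift over the finite alphabet `{0, …, m - 1}`: a closed set of sequences (product of
the discrete topologies) that is mapped into itself by the shift map. -/
def IsShift {m : ℕ} (X : Set (ℕ → Fin m)) : Prop :=
  IsClosed X ∧ ∀ x ∈ X, (fun i => x (i + 1)) ∈ X

/-- Hereditary: if `x ∈ X` and `y i ≤ x i` for every `i`, then `y ∈ X`. -/
def IsHereditary {m : ℕ} (X : Set (ℕ → Fin m)) : Prop :=
  ∀ x ∈ X, ∀ y : ℕ → Fin m, (∀ i, y i ≤ x i) → y ∈ X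

/-- The set of `n`-blocks that occur somewhere in a point of `X`. -/
def blocks {m : ℕ} (X : Set (ℕ → Fin m)) (n : ℕ) : Set (Fin n → Fin m) :=
  {w | ∃ x ∈ X, ∃ k : ℕ, ∀ j : Fin n, w j = x (k + j)}

/-- The entropy of a shift. The upper limit is a limit, see `tendsto_entropy`. -/
noncomputable def entropy {m : ℕ} (X : Set (ℕ → Fin m)) : ℝ :=
  limsup (fun n : ℕ => Real.log ((blocks X n).ncard : ℝ) / n) atTop

/-- The upper limit in the definition of `entropy` is a limit. -/
theorem tendsto_entropy {m : ℕ} (X : Set (ℕ → Fin m)) :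
    Tendsto (fun n : ℕ => Real.log ((blocks X n).ncard : ℝ) / n) atTop (𝓝 (entropy X)) := by
  have hsub : Subadditive (fun n : ℕ => Real.log ((blocks X n).ncard : ℝ)) := by
    intro a b
    rcases X.eq_empty_or_nonempty with rfl | ⟨x, hx⟩
    · simp [blocks]
    have hne : ∀ n, 0 < (blocks X n).ncard := fun n =>
      (Set.ncard_pos (Set.toFinite _)).2 ⟨fun j => x (0 + j), x, hx, 0, fun _ => rfl⟩
    have hle : (blocks X (a + b)).ncard ≤ (blocks X a).ncard * (blocks X b).ncard := by
      rw [← Set.ncard_prod]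
      refine Set.ncard_le_ncard_of_injOn
        (fun w => (fun j => w (Fin.castAdd b j), fun j => w (Fin.natAdd a j))) ?_ ?_
        (Set.toFinite _)
      · rintro w ⟨y, hy, k, hw⟩
        refine ⟨⟨y, hy, k, fun j => by simp [hw]⟩, ⟨y, hy, k + a, fun j => ?_⟩⟩
        simp [hw, add_assoc]
      · intro w _ v _ h
        simp only [Prod.mk.injEq] at h
        funext j
        refine Fin.addCases (fun i => congrFun h.1 i) (fun i => congrFun h.2 i) j
    have h1 : (0 : ℝ) < (blocks X a).ncard := by exact_mod_cast hne a
    have h2 : (0 : ℝ) < (blocks X b).ncard := by exact_mod_cast hne b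
    have h3 : (0 : ℝ) < (blocks X (a + b)).ncard := by exact_mod_cast hne (a + b)
    rw [← Real.log_mul h1.ne' h2.ne']
    exact Real.log_le_log h3 (by exact_mod_cast hle)
  have hbdd : BddBelow
      (Set.range fun n : ℕ => Real.log ((blocks X n).ncard : ℝ) / n) := by
    refine ⟨0, ?_⟩
    rintro _ ⟨n, rfl⟩
    exact div_nonneg (Real.log_natCast_nonneg _) (Nat.cast_nonneg _)
  have h := hsub.tendsto_lim hbdd
  have h' : entropy X = hsub.lim := h.limsup_eq
  rw [h']
  exact h

/-! ### Rooted trees -/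

/-- A rooted locally finite tree whose vertices are words over a set `α` of generators: the root is
the empty word, and the parent of `g₁ ⋯ gₙ gₙ₊₁` is `g₁ ⋯ gₙ`. -/
structure WordTree (α : Type*) where
  /-- the set of vertices -/
  carrier : Set (List α)
  nil_mem : [] ∈ carrier
  prefix_closed : ∀ (w : List α) (a : α), w ++ [a] ∈ carrier → w ∈ carrier
  locally_finite : ∀ w ∈ carrier, {a : α | w ++ [a] ∈ carrier}.Finite

/-- The Markov–Cayley tree of a `d × d` matrix with entries in `{0, 1}`: all the words
`g_{i₁} ⋯ g_{iₙ}` with `M i_j i_{j+1} = 1` for consecutive letters (all words of length at most one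
are admitted). -/
def markovCayley {d : ℕ} (M : Matrix (Fin d) (Fin d) (Fin 2)) : WordTree (Fin d) where
  carrier := {w | w.IsChain (fun i j => M i j = 1)}
  nil_mem := List.IsChain.nil
  prefix_closed := fun _ _ h => List.IsChain.left_of_append h
  locally_finite := fun _ _ => Set.toFinite _

namespace WordTree

variable {α : Type*} (T : WordTree α)

/-- The type of vertices of the tree. -/
abbrev Vertex : Type _ := {w : List α // w ∈ T.carrier}

/-- `T_n`, the set of vertices at distance `n` from the root. -/
def level (n : ℕ) : Set T.Vertex := {v | v.1.length = n}

/-- `Δ_n`, the union of `T_0, …, T_n`. -/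
def ball (n : ℕ) : Set T.Vertex := {v | v.1.length ≤ n}

/-- Every vertex has a child; equivalently, every vertex lies on an infinite ray from the root. -/
def Leafless : Prop := ∀ w ∈ T.carrier, ∃ a : α, w ++ [a] ∈ T.carrier

/-- The expanding number `lim |T_{n+1}| / |T_n|` exists and is `1`. -/
def Unexpandable : Prop :=
  Tendsto (fun n : ℕ => ((T.level (n + 1)).ncard : ℝ) / ((T.level n).ncard : ℝ)) atTop (𝓝 1)

/-- An infinite ray: it starts at the root and goes from each vertex to one of its children. -/
def IsRay (ρ : ℕ → T.Vertex) : Prop :=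
  (ρ 0).1 = [] ∧ ∀ n, ∃ a : α, (ρ (n + 1)).1 = (ρ n).1 ++ [a]

/-- The tree-shift associated with the base shift `X`: the labelled trees whose labels along every
infinite ray form a point of `X`. -/
def treeShift {m : ℕ} (X : Set (ℕ → Fin m)) : Set (T.Vertex → Fin m) :=
  {t | ∀ ρ : ℕ → T.Vertex, T.IsRay ρ → (fun n => t (ρ n)) ∈ X}

variable {T}

/-- The projection of a set of labelled trees to the patterns on `Δ_n`. -/
def patterns {m : ℕ} (𝒯 : Set (T.Vertex → Fin m)) (n : ℕ) : Set (T.ball n → Fin m) :=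
  (T.ball n).domRestrict '' 𝒯

/-- The entropy of a tree-shift, `limsup (log |P(Δ_n, 𝒯)|) / |Δ_n|`. -/
noncomputable def treeEntropy {m : ℕ} (𝒯 : Set (T.Vertex → Fin m)) : ℝ :=
  limsup (fun n : ℕ => Real.log ((patterns 𝒯 n).ncard : ℝ) / ((T.ball n).ncard : ℝ)) atTop

/-- `S` is an independence set of `𝒯`: every labelling of `S` extends to a member of `𝒯`. -/
def IsIndependenceSet {m : ℕ} (𝒯 : Set (T.Vertex → Fin m)) (S : Set T.Vertex) : Prop :=
  ∀ u : S → Fin m, ∃ t ∈ 𝒯, ∀ g : S, t g = u g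

/-- The density `lim |S ∩ Δ_n| / |Δ_n|` exists and equals `δ`. -/
def HasDensity (S : Set T.Vertex) (δ : ℝ) : Prop :=
  Tendsto (fun n : ℕ => ((S ∩ T.ball n).ncard : ℝ) / ((T.ball n).ncard : ℝ)) atTop (𝓝 δ)

/-- The upper density `limsup |S ∩ Δ_n| / |Δ_n|`. -/
noncomputable def upperDensity (S : Set T.Vertex) : ℝ :=
  limsup (fun n : ℕ => ((S ∩ T.ball n).ncard : ℝ) / ((T.ball n).ncard : ℝ)) atTop

/-- Local finiteness makes the cardinality of `Δ_n` finite. -/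
theorem finite_ball (n : ℕ) : (T.ball n).Finite := by
  induction n with
  | zero =>
    refine (Set.finite_singleton (⟨[], T.nil_mem⟩ : T.Vertex)).subset ?_
    intro v hv
    have hv' : v.1.length ≤ 0 := hv
    exact Subtype.ext (List.length_eq_zero_iff.1 (Nat.le_zero.1 hv'))
  | succ n ih =>
    have hC : ∀ v : T.Vertex, {c : T.Vertex | ∃ a, c.1 = v.1 ++ [a]}.Finite := by
      intro v
      refine Set.Finite.of_finite_image (f := Subtype.val) ?_ Subtype.val_injective.injOn
      refine ((T.locally_finite v.1 v.2).image fun a => v.1 ++ [a]).subset ?_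
      rintro _ ⟨c, ⟨a, ha⟩, rfl⟩
      refine ⟨a, ?_, ha.symm⟩
      have hc := c.2
      rw [ha] at hc
      exact hc
    refine ((ih.biUnion fun v _ => hC v).union
      (Set.finite_singleton (⟨[], T.nil_mem⟩ : T.Vertex))).subset ?_
    rintro ⟨w, hw⟩ hv
    rcases List.eq_nil_or_concat' w with rfl | ⟨l, a, rfl⟩
    · exact Or.inr rfl
    · refine Or.inl (Set.mem_biUnion (x := (⟨l, T.prefix_closed l a hw⟩ : T.Vertex)) ?_ ⟨a, rfl⟩)
      have hv' : (l ++ [a]).length ≤ n + 1 := hv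
      simp only [List.length_append, List.length_singleton] at hv'
      show l.length ≤ n
      omega

end WordTree

end TreeShift

open TreeShift TreeShift.WordTree

/-! Fix a child of every vertex of a leafless tree. The paths of chosen children partition the tree,
and those meeting `Δ_n` inject into `T_n` (`card_starts_le`). In an unexpandable tree `|T_n|` is
negligible against `|Δ_n|`, so `Δ_n` consists mostly of long path segments and averages along paths
pass to `Δ_n` (`Unexpandable.tendsto_sum_starts_div_ball`). Every path segment lies on a ray, so a
pattern on `Δ_n` is a choice of one block of `X` per path. This bounds the tree entropy by `h(X)`
for any unexpandable tree, and since an independence set forces `m ^ |S ∩ Δ_n|` patterns, it also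
bounds the upper density of such sets.

For the lower bound, call a vertex thin if nothing branches below it. In a Markov–Cayley tree the
future of a vertex depends only on its last letter, so a non-thin vertex branches within a bounded
distance `K`; hence `|Δ_n \ thin| ≤ |Δ_{n+K}| - |Δ_n|`, which is negligible. For hereditary `X`, put
`0` off the thin vertices and label the thin part of each path independently: a ray that enters the
thin part stays on one path, so no conflict arises (`mem_treeShift_of_hereditary`).

For independence sets, `h(X) > log (m - 1)` forces the top letter to have positive maximal
frequency. Compactness yields a point attaining this frequency that can be preceded by arbitrarily
many letters in `X` (`IsShift.exists_frequency_eq`). Copying the positions of its top letter to all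
paths and keeping the thin ones gives the set. -/

namespace TreeShift

/-! ### Blocks of a shift read at a fixed position. -/

section Shift

variable {m : ℕ} {X : Set (ℕ → Fin m)}

/-- The set of `n`-blocks that occur at position `i` in a point of `X`. -/
def blocksAt (X : Set (ℕ → Fin m)) (i n : ℕ) : Set (Fin n → Fin m) :=
  {w | ∃ x ∈ X, ∀ j : Fin n, w j = x (i + j)}

theorem IsShift.shift_mem (hX : IsShift X) {x : ℕ → Fin m} (hx : x ∈ X) (k : ℕ) :
    (fun j => x (k + j)) ∈ X := by
  induction k with
  | zero => simpa using hx
  | succ k ih =>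
    have := hX.2 _ ih
    convert this using 2 with j
    congr 1
    omega

theorem blocksAt_subset_blocks (i n : ℕ) : blocksAt X i n ⊆ blocks X n :=
  fun _ ⟨x, hx, h⟩ => ⟨x, hx, i, h⟩

theorem IsShift.blocks_eq_blocksAt (hX : IsShift X) (n : ℕ) : blocks X n = blocksAt X 0 n := by
  refine Set.Subset.antisymm ?_ (blocksAt_subset_blocks 0 n)
  rintro w ⟨x, hx, k, h⟩
  exact ⟨_, hX.shift_mem hx k, fun j => by simp [h]⟩

/-- The inclusion can be strict, because `σ(X) = X` is not assumed. This is why the position at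
which a path starts has to be recorded. -/
theorem IsShift.blocksAt_add_subset (hX : IsShift X) (i k n : ℕ) :
    blocksAt X (i + k) n ⊆ blocksAt X i n := by
  rintro w ⟨x, hx, h⟩
  refine ⟨_, hX.shift_mem hx k, fun j => ?_⟩
  rw [h]
  congr 1
  omega

theorem blocksAt_nonempty (hne : X.Nonempty) (i n : ℕ) : (blocksAt X i n).Nonempty :=
  let ⟨x, hx⟩ := hne
  ⟨fun j => x (i + j), x, hx, fun _ => rfl⟩

theorem blocksAt_ncard_pos (hne : X.Nonempty) (i n : ℕ) : 0 < (blocksAt X i n).ncard :=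
  (Set.ncard_pos (Set.toFinite _)).2 (blocksAt_nonempty hne i n)

theorem ncard_blocksAt_le_pow (i n : ℕ) : (blocksAt X i n).ncard ≤ m ^ n := by
  refine (Set.ncard_le_ncard (Set.subset_univ _)).trans ?_
  simp [Set.ncard_univ]

theorem ncard_blocksAt_add_le (i a b : ℕ) :
    (blocksAt X i (a + b)).ncard ≤ (blocksAt X i a).ncard * (blocksAt X (i + a) b).ncard := by
  rw [← Set.ncard_prod]
  refine Set.ncard_le_ncard_of_injOn
    (fun w => (fun j => w (Fin.castAdd b j), fun j => w (Fin.natAdd a j))) ?_ ?_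
    (Set.toFinite _)
  · rintro w ⟨y, hy, hw⟩
    refine ⟨⟨y, hy, fun j => by simp [hw]⟩, ⟨y, hy, fun j => ?_⟩⟩
    simp [hw, add_assoc]
  · intro w _ v _ h
    simp only [Prod.mk.injEq] at h
    funext j
    exact Fin.addCases (fun i => congrFun h.1 i) (fun i => congrFun h.2 i) j

theorem IsShift.subadditive_log_blocksAt (hX : IsShift X) (hne : X.Nonempty) (i : ℕ) :
    Subadditive fun n : ℕ => Real.log ((blocksAt X i n).ncard : ℝ) := by
  intro a b
  have h1 : (0 : ℝ) < (blocksAt X i a).ncard := by exact_mod_cast blocksAt_ncard_pos hne i a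
  have h2 : (0 : ℝ) < (blocksAt X i b).ncard := by exact_mod_cast blocksAt_ncard_pos hne i b
  have h3 : (0 : ℝ) < (blocksAt X i (a + b)).ncard := by
    exact_mod_cast blocksAt_ncard_pos hne i (a + b)
  have hle : (blocksAt X i (a + b)).ncard ≤ (blocksAt X i a).ncard * (blocksAt X i b).ncard :=
    (ncard_blocksAt_add_le i a b).trans
      (Nat.mul_le_mul_left _ (Set.ncard_le_ncard (hX.blocksAt_add_subset i a b)))
  rw [← Real.log_mul h1.ne' h2.ne']
  exact Real.log_le_log h3 (by exact_mod_cast hle)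

theorem bddBelow_log_div (u : ℕ → ℕ) :
    BddBelow (Set.range fun n : ℕ => Real.log (u n : ℝ) / n) := by
  refine ⟨0, ?_⟩
  rintro _ ⟨n, rfl⟩
  exact div_nonneg (Real.log_natCast_nonneg _) (Nat.cast_nonneg _)

/-- However far to the right one starts reading, there are at least `exp (n h)` blocks. -/
theorem IsShift.entropy_mul_le_log_blocksAt (hX : IsShift X) (hne : X.Nonempty) (i n : ℕ) :
    entropy X * n ≤ Real.log ((blocksAt X i n).ncard : ℝ) := by
  have hsub := hX.subadditive_log_blocksAt hne i
  have hbdd := bddBelow_log_div fun n => (blocksAt X i n).ncard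
  have hlim := hsub.tendsto_lim hbdd
  have hshift : Tendsto (fun n : ℕ => Real.log ((blocks X (i + n)).ncard : ℝ) / ((i + n : ℕ) : ℝ))
      atTop (𝓝 (entropy X)) :=
    (tendsto_entropy X).comp (tendsto_atTop_mono (fun n => Nat.le_add_left n i) tendsto_id)
  have hC : Tendsto (fun n : ℕ => Real.log ((m : ℝ) ^ i) / (n : ℝ)) atTop (𝓝 0) :=
    tendsto_const_nhds.div_atTop tendsto_natCast_atTop_atTop
  -- A block of length `i + k` is a prefix with at most `m ^ i` values followed by a block read at
  -- position `i`; the factor `m ^ i` is lost on dividing by `k`. By Fekete the limit is an infimum,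
  -- so the bound then holds for each `n`.
  have hle : entropy X ≤ hsub.lim := by
    have := hC.add hlim
    rw [zero_add] at this
    refine le_of_tendsto_of_tendsto hshift this ?_
    filter_upwards [eventually_gt_atTop 0] with k hk
    have hk' : (0 : ℝ) < k := by exact_mod_cast hk
    have h1 : (0 : ℝ) < (blocksAt X 0 i).ncard := by exact_mod_cast blocksAt_ncard_pos hne 0 i
    have h2 : (0 : ℝ) < (blocksAt X i k).ncard := by exact_mod_cast blocksAt_ncard_pos hne i k
    have h3 : (0 : ℝ) < (blocksAt X 0 (i + k)).ncard := by
      exact_mod_cast blocksAt_ncard_pos hne 0 (i + k)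
    have h4 := ncard_blocksAt_add_le (X := X) 0 i k
    rw [zero_add] at h4
    have h5 : Real.log ((blocksAt X 0 (i + k)).ncard : ℝ) ≤
        Real.log ((blocksAt X 0 i).ncard : ℝ) + Real.log ((blocksAt X i k).ncard : ℝ) := by
      rw [← Real.log_mul h1.ne' h2.ne']
      exact Real.log_le_log h3 (by exact_mod_cast h4)
    have h6 : Real.log ((blocksAt X 0 i).ncard : ℝ) ≤ Real.log ((m : ℝ) ^ i) :=
      Real.log_le_log h1 (by exact_mod_cast ncard_blocksAt_le_pow 0 i)
    rw [hX.blocks_eq_blocksAt, ← add_div]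
    refine div_le_div₀ ?_ (h5.trans (by linarith)) hk' (by push_cast; linarith)
    have : 0 ≤ Real.log ((blocksAt X i k).ncard : ℝ) := Real.log_natCast_nonneg _
    have : 0 ≤ Real.log ((blocksAt X 0 i).ncard : ℝ) := Real.log_natCast_nonneg _
    linarith
  rcases Nat.eq_zero_or_pos n with rfl | hn
  · simpa using Real.log_natCast_nonneg (blocksAt X i 0).ncard
  · have hn' : (0 : ℝ) < n := by exact_mod_cast hn
    exact (le_div_iff₀ hn').1 (hle.trans (hsub.lim_le_div hbdd hn.ne'))

/-! ### The maximal frequency of a letter -/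

/-- The largest number of occurrences of the letter `a` among the first `n` letters of a point. -/
noncomputable def maxCount (X : Set (ℕ → Fin m)) (a : Fin m) (n : ℕ) : ℕ :=
  sSup ((fun x => Nat.count (fun i => x i = a) n) '' X)

theorem bddAbove_count (X : Set (ℕ → Fin m)) (a : Fin m) (n : ℕ) :
    BddAbove ((fun x => Nat.count (fun i => x i = a) n) '' X) := by
  refine ⟨n, ?_⟩
  rintro _ ⟨x, -, rfl⟩
  exact Nat.count_le _

theorem count_le_maxCount {x : ℕ → Fin m} (hx : x ∈ X) (a : Fin m) (n : ℕ) :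
    Nat.count (fun i => x i = a) n ≤ maxCount X a n :=
  le_csSup (bddAbove_count X a n) ⟨x, hx, rfl⟩

theorem exists_count_eq_maxCount (hne : X.Nonempty) (a : Fin m) (n : ℕ) :
    ∃ x ∈ X, Nat.count (fun i => x i = a) n = maxCount X a n :=
  Nat.sSup_mem (hne.image _) (bddAbove_count X a n)

theorem IsShift.subadditive_maxCount (hX : IsShift X) (hne : X.Nonempty) (a : Fin m) :
    Subadditive fun n => (maxCount X a n : ℝ) := by
  intro k l
  obtain ⟨x, hx, h⟩ := exists_count_eq_maxCount hne a (k + l)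
  have h1 := count_le_maxCount hx a k
  have h2 := count_le_maxCount (hX.shift_mem hx k) a l
  rw [Nat.count_add] at h
  have : maxCount X a (k + l) ≤ maxCount X a k + maxCount X a l := by omega
  dsimp only
  exact_mod_cast this

theorem bddBelow_maxCount_div (X : Set (ℕ → Fin m)) (a : Fin m) :
    BddBelow (Set.range fun n : ℕ => (maxCount X a n : ℝ) / n) := by
  refine ⟨0, ?_⟩
  rintro _ ⟨n, rfl⟩
  positivity

/-- The limiting maximal frequency of the letter `a` in a nonempty shift. -/
theorem IsShift.exists_tendsto_maxCount (hX : IsShift X) (hne : X.Nonempty) (a : Fin m) :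
    ∃ A : ℝ, 0 ≤ A ∧ (∀ n : ℕ, A * n ≤ maxCount X a n) ∧
      Tendsto (fun n : ℕ => (maxCount X a n : ℝ) / n) atTop (𝓝 A) := by
  have hsub := hX.subadditive_maxCount hne a
  have hbdd := bddBelow_maxCount_div X a
  have hlim := hsub.tendsto_lim hbdd
  refine ⟨hsub.lim, ge_of_tendsto' hlim fun n => by positivity, fun n => ?_, hlim⟩
  rcases Nat.eq_zero_or_pos n with rfl | hn
  · simp
  · exact (le_div_iff₀ (by exact_mod_cast hn)).1 (hsub.lim_le_div hbdd hn.ne')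

theorem prod_ite_eq_pow_count {R : Type*} [CommMonoid R] (z : R) (p : ℕ → Prop) [DecidablePred p]
    (n : ℕ) : ∏ j : Fin n, (if p j then z else 1) = z ^ Nat.count p n := by
  induction n with
  | zero => simp
  | succ n ih =>
    rw [Fin.prod_univ_castSucc, Nat.count_succ, pow_add]
    simp only [Fin.val_castSucc, Fin.val_last, ih]
    split_ifs <;> simp

/-- Weight each word by `z` to the number of its letters `a`. All words together weigh `(m - 1 + z)
^ n`, and since `z ≤ 1` each block of `X` weighs at least `z ^ maxCount X a n`. -/
theorem IsShift.ncard_blocks_mul_pow_le (hX : IsShift X) (a : Fin m) (n : ℕ) {z : ℝ} (hz : 0 < z)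
    (hz1 : z ≤ 1) :
    ((blocks X n).ncard : ℝ) * z ^ maxCount X a n ≤ ((m : ℝ) - 1 + z) ^ n := by
  classical
  have hsum : ∑ b : Fin m, (if b = a then z else 1) = (m : ℝ) - 1 + z := by
    rw [Finset.sum_ite, Finset.sum_const, Finset.sum_const, Finset.filter_eq' Finset.univ a]
    have hc : (Finset.univ.filter fun b : Fin m => ¬ b = a).card = m - 1 := by
      rw [Finset.filter_not, Finset.filter_eq' Finset.univ a]
      simp [Finset.card_sdiff]
    rw [hc]
    have hm : 1 ≤ m := a.pos
    simp [Nat.cast_sub hm]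
    ring
  have hprod : ((m : ℝ) - 1 + z) ^ n =
      ∑ w : Fin n → Fin m, ∏ j, (if w j = a then z else 1) := by
    rw [← hsum, ← Fintype.prod_sum fun (_ : Fin n) (b : Fin m) => if b = a then z else (1 : ℝ)]
    simp
  have hfin : (blocks X n).Finite := Set.toFinite _
  rw [hprod, Set.ncard_eq_toFinset_card _ hfin, ← nsmul_eq_mul]
  refine le_trans (Finset.card_nsmul_le_sum hfin.toFinset
    (fun w => ∏ j, (if w j = a then z else 1)) _ ?_) ?_
  · intro w hw
    rw [Set.Finite.mem_toFinset, hX.blocks_eq_blocksAt] at hw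
    obtain ⟨x, hx, h⟩ := hw
    simp only [h, zero_add]
    rw [prod_ite_eq_pow_count z (fun j => x j = a)]
    exact pow_le_pow_of_le_one hz.le hz1 (count_le_maxCount hx a n)
  · refine Finset.sum_le_sum_of_subset_of_nonneg (Finset.subset_univ _) fun w _ _ => ?_
    refine Finset.prod_nonneg fun j _ => ?_
    split_ifs <;> positivity

/-- If `maxCount` is `o(n)`, the weighted count gives `h(X) ≤ log (m - 1 + z)` for every `z` in `(0,
1]`; then let `z → 0`. -/
theorem IsShift.entropy_le_of_maxCount (hX : IsShift X) (hne : X.Nonempty) (hm : 2 ≤ m) (a : Fin m)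
    (h0 : Tendsto (fun n : ℕ => (maxCount X a n : ℝ) / n) atTop (𝓝 0)) :
    entropy X ≤ Real.log ((m : ℝ) - 1) := by
  have hm' : (2 : ℝ) ≤ m := by exact_mod_cast hm
  have key : ∀ z : ℝ, 0 < z → z ≤ 1 → entropy X ≤ Real.log ((m : ℝ) - 1 + z) := by
    intro z hz hz1
    have hlim : Tendsto (fun n : ℕ => Real.log ((m : ℝ) - 1 + z) +
        (maxCount X a n : ℝ) / n * (- Real.log z)) atTop
        (𝓝 (Real.log ((m : ℝ) - 1 + z) + 0 * (- Real.log z))) :=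
      tendsto_const_nhds.add (h0.mul_const _)
    rw [zero_mul, add_zero] at hlim
    refine le_of_tendsto_of_tendsto (tendsto_entropy X) hlim ?_
    filter_upwards [eventually_gt_atTop 0] with n hn
    have hn' : (0 : ℝ) < n := by exact_mod_cast hn
    have hpos : (0 : ℝ) < (blocks X n).ncard := by
      rw [hX.blocks_eq_blocksAt]
      exact_mod_cast blocksAt_ncard_pos hne 0 n
    have h1 := Real.log_le_log (by positivity) (hX.ncard_blocks_mul_pow_le a n hz hz1)
    rw [Real.log_mul hpos.ne' (by positivity), Real.log_pow, Real.log_pow] at h1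
    rw [div_le_iff₀ hn']
    have : (Real.log ((m : ℝ) - 1 + z) + (maxCount X a n : ℝ) / n * (- Real.log z)) * n =
        n * Real.log ((m : ℝ) - 1 + z) - maxCount X a n * Real.log z := by
      field_simp
      ring
    rw [this]
    linarith
  have hcont : Tendsto (fun n : ℕ => Real.log ((m : ℝ) - 1 + 1 / ((n : ℝ) + 1))) atTop
      (𝓝 (Real.log ((m : ℝ) - 1 + 0))) :=
    (tendsto_const_nhds.add tendsto_one_div_add_atTop_nhds_zero_nat).log (by linarith)
  rw [add_zero] at hcont
  refine ge_of_tendsto' hcont fun n => key _ (by positivity) ?_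
  rw [div_le_one (by positivity)]
  linarith [(Nat.cast_nonneg n : (0 : ℝ) ≤ n)]

theorem continuous_count (a : Fin m) (n : ℕ) :
    Continuous fun x : ℕ → Fin m => (Nat.count (fun i => x i = a) n : ℝ) := by
  induction n with
  | zero => simpa using continuous_const
  | succ n ih =>
    have h : Continuous fun x : ℕ → Fin m => (if x n = a then (1 : ℝ) else 0) :=
      (continuous_of_discreteTopology (f := fun b : Fin m => if b = a then (1 : ℝ) else 0)).comp
        (continuous_apply n)
    convert ih.add h using 2 with x
    rw [Nat.count_succ]
    push_cast
    rfl

/-- A long word with large frequency of `a` contains, away from its beginning, a position from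
which all the counts of `a` are large. -/
theorem exists_position_count_ge {p : ℕ → Prop} [DecidablePred p] {A ε : ℝ} (hA : 0 ≤ A) (hε1 : ε ≤ 1) {N L : ℕ} (hL : 3 * N ≤ ε * L)
    (hp : A * (N + L : ℕ) ≤ Nat.count p (N + L)) :
    ∃ j, N ≤ j ∧ ∀ n ≤ N, (A - ε) * n ≤ Nat.count (fun i => p (j + i)) n := by
  set f : ℕ → ℝ := fun j => Nat.count p j - (A - ε) * j with hf
  -- Minimality of `f` at `j` says exactly that every count started at `j` has frequency at least `A
  -- - ε`, as long as the window stays inside the interval.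
  obtain ⟨j, hj, hmin⟩ := Finset.exists_min_image (Finset.Icc N (N + L)) f ⟨N, by simp⟩
  rw [Finset.mem_Icc] at hj
  have hfN : f j ≤ f N := hmin N (by simp)
  obtain ⟨r, hr⟩ := Nat.exists_eq_add_of_le hj.2
  have hcount : (Nat.count p (N + L) : ℝ) ≤ Nat.count p j + r := by
    rw [hr, Nat.count_add]
    push_cast
    have : Nat.count (fun k => p (j + k)) r ≤ r := Nat.count_le _
    have : (Nat.count (fun k => p (j + k)) r : ℝ) ≤ r := by exact_mod_cast this
    linarith
  have hNle : (Nat.count p N : ℝ) ≤ N := by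
    exact_mod_cast (Nat.count_le p : Nat.count p N ≤ N)
  have hr' : (N : ℝ) + L = j + r := by exact_mod_cast hr
  -- The minimizer leaves room for windows of length `N`: comparing `f j` with `f N` gives `A N + ε
  -- L ≤ N + (1 - A + ε) r ≤ N + 2 r`, while `ε L ≥ 3 N`.
  have hrN : N ≤ r := by
    have h0 : (0 : ℝ) ≤ r := Nat.cast_nonneg r
    have hN0 : (0 : ℝ) ≤ N := Nat.cast_nonneg N
    simp only [hf] at hfN
    push_cast at hp
    have h1 : (A - ε) * (N + L) = (A - ε) * (j + r) := by rw [hr']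
    have : (N : ℝ) ≤ r := by nlinarith [mul_nonneg hA hN0, mul_nonneg hA h0]
    exact_mod_cast this
  refine ⟨j, hj.1, fun n hn => ?_⟩
  have h := hmin (j + n) (by rw [Finset.mem_Icc]; omega)
  simp only [hf] at h
  rw [Nat.count_add] at h
  push_cast at h
  linarith

/-- There is a point in the intersection of all the images of the shift map in which the letter `a`
has the maximal possible frequency. -/
theorem IsShift.exists_frequency_eq (hX : IsShift X) (hne : X.Nonempty) (a : Fin m) {A : ℝ}
    (hA : 0 ≤ A) (hmul : ∀ n : ℕ, A * n ≤ maxCount X a n)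
    (hlim : Tendsto (fun n : ℕ => (maxCount X a n : ℝ) / n) atTop (𝓝 A)) :
    ∃ x : ℕ → Fin m, (∀ k, ∃ y ∈ X, ∀ j, y (k + j) = x j) ∧
      Tendsto (fun n : ℕ => (Nat.count (fun i => x i = a) n : ℝ) / n) atTop (𝓝 A) := by
  -- A decreasing sequence of compact sets: points of `σ^N X` whose frequencies up to time `N` are
  -- almost maximal, with a tolerance tending to `0`.
  let K : ℕ → Set (ℕ → Fin m) := fun N =>
    (fun (y : ℕ → Fin m) j => y (N + j)) '' X ∩
      {x | ∀ n : ℕ, n ≤ N → (A - 1 / ((N : ℝ) + 1)) * n ≤ (Nat.count (fun i => x i = a) n : ℝ)}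
  have himage : ∀ N, IsCompact ((fun (y : ℕ → Fin m) j => y (N + j)) '' X) := fun N =>
    hX.1.isCompact.image (continuous_pi fun j => continuous_apply (N + j))
  have hclosed : ∀ N, IsClosed {x : ℕ → Fin m | ∀ n : ℕ, n ≤ N →
      (A - 1 / ((N : ℝ) + 1)) * n ≤ (Nat.count (fun i => x i = a) n : ℝ)} := by
    intro N
    simp only [Set.ofPred_forall]
    exact isClosed_iInter fun n => isClosed_iInter fun _ =>
      isClosed_le continuous_const (continuous_count a n)
  have hKne : ∀ N, (K N).Nonempty := by
    intro N
    obtain ⟨y, hy, hcount⟩ := exists_count_eq_maxCount hne a (N + 3 * N * (N + 1))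
    have hε1 : 1 / ((N : ℝ) + 1) ≤ 1 := by
      rw [div_le_one (by positivity)]
      linarith [(Nat.cast_nonneg N : (0 : ℝ) ≤ N)]
    -- With `ε = 1 / (N + 1)`, this `L` makes `ε L = 3 N`. The bound `N ≤ j` puts the tail of `y` at
    -- `j` in `σ^N X`.
    obtain ⟨j, hNj, hj⟩ := exists_position_count_ge (p := fun i => y i = a) hA hε1
      (N := N) (L := 3 * N * (N + 1)) (by push_cast; field_simp; exact le_rfl)
      (by rw [hcount]; exact hmul _)
    refine ⟨fun i => y (j + i), ⟨_, hX.shift_mem hy (j - N), ?_⟩, hj⟩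
    funext i
    show y (j - N + (N + i)) = y (j + i)
    congr 1
    omega
  obtain ⟨x, hx⟩ := IsCompact.nonempty_iInter_of_sequence_nonempty_isCompact_isClosed K
    (by
      rintro N x ⟨⟨y, hy, rfl⟩, h⟩
      refine ⟨⟨_, hX.shift_mem hy 1, ?_⟩, fun n hn => le_trans ?_ (h n (by omega))⟩
      · funext j
        show y (1 + (N + j)) = y (N + 1 + j)
        congr 1
        omega
      · refine mul_le_mul_of_nonneg_right ?_ (Nat.cast_nonneg n)
        have : 1 / (((N + 1 : ℕ) : ℝ) + 1) ≤ 1 / ((N : ℝ) + 1) := by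
          apply one_div_le_one_div_of_le (by positivity)
          push_cast
          linarith
        linarith)
    hKne ((himage 0).inter_right (hclosed 0))
    (fun N => (himage N).isClosed.inter (hclosed N))
  rw [Set.mem_iInter] at hx
  have hmem : ∀ k, ∃ y ∈ X, ∀ j, y (k + j) = x j := fun k =>
    let ⟨y, hy, h⟩ := (hx k).1
    ⟨y, hy, fun j => congrFun h j⟩
  have hxX : x ∈ X := by
    obtain ⟨y, hy, h⟩ := hmem 0
    have : y = x := funext fun j => by simpa using h j
    exact this ▸ hy
  refine ⟨x, hmem, tendsto_of_tendsto_of_tendsto_of_le_of_le' (g := fun n : ℕ =>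
    A - 1 / ((n : ℝ) + 1)) ?_ hlim ?_ ?_⟩
  · simpa using tendsto_const_nhds.sub (tendsto_one_div_add_atTop_nhds_zero_nat (𝕜 := ℝ))
  · filter_upwards [eventually_gt_atTop 0] with n hn
    rw [le_div_iff₀ (by exact_mod_cast hn)]
    exact (hx n).2 n le_rfl
  · refine Eventually.of_forall fun n => ?_
    gcongr
    exact count_le_maxCount hxX a n

theorem IsShift.exists_pos_frequency (hX : IsShift X) (hne : X.Nonempty) (hm : 2 ≤ m) (a : Fin m)
    (h : Real.log ((m : ℝ) - 1) < entropy X) :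
    ∃ x : ℕ → Fin m, (∀ k, ∃ y ∈ X, ∀ j, y (k + j) = x j) ∧ ∃ A : ℝ, 0 < A ∧
      Tendsto (fun n : ℕ => (Nat.count (fun i => x i = a) n : ℝ) / n) atTop (𝓝 A) := by
  obtain ⟨A, hA, hmul, hlim⟩ := hX.exists_tendsto_maxCount hne a
  obtain ⟨x, hx, hxA⟩ := hX.exists_frequency_eq hne a hA hmul hlim
  refine ⟨x, hx, A, lt_of_le_of_ne hA ?_, hxA⟩
  rintro rfl
  exact h.not_ge (hX.entropy_le_of_maxCount hne hm a hlim)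

end Shift

end TreeShift

namespace TreeShift.WordTree

variable {α : Type*} {T : WordTree α}

theorem mem_carrier_of_append {u v : List α} (h : u ++ v ∈ T.carrier) : u ∈ T.carrier := by
  induction v using List.reverseRecOn with
  | nil => simpa using h
  | append_singleton v a ih =>
    rw [← List.append_assoc] at h
    exact ih (T.prefix_closed _ _ h)

theorem take_mem_carrier {w : List α} (h : w ∈ T.carrier) (k : ℕ) : w.take k ∈ T.carrier :=
  mem_carrier_of_append (v := w.drop k) (by rwa [List.take_append_drop])

/-! ### The decomposition of a leafless tree into paths -/

namespace Leafless

variable (hT : T.Leafless)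

/-- A chosen child of a vertex. -/
noncomputable def grow (v : T.Vertex) : T.Vertex :=
  ⟨v.1 ++ [(hT v.1 v.2).choose], (hT v.1 v.2).choose_spec⟩

theorem length_grow (v : T.Vertex) : (hT.grow v).1.length = v.1.length + 1 := by
  simp [grow]

theorem prefix_grow (v : T.Vertex) : v.1 <+: (hT.grow v).1 := List.prefix_append _ _

theorem grow_injective : Function.Injective hT.grow := by
  intro v w h
  have h' : v.1 ++ _ = w.1 ++ _ := congrArg Subtype.val h
  exact Subtype.ext (List.append_inj_left' h' rfl)

theorem length_iterate_grow (k : ℕ) (v : T.Vertex) :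
    (hT.grow^[k] v).1.length = v.1.length + k := by
  induction k with
  | zero => rfl
  | succ k ih => rw [Function.iterate_succ_apply', length_grow, ih, add_assoc]

theorem prefix_iterate_grow (k : ℕ) (v : T.Vertex) : v.1 <+: (hT.grow^[k] v).1 := by
  induction k with
  | zero => exact List.prefix_rfl
  | succ k ih =>
    rw [Function.iterate_succ_apply']
    exact ih.trans (hT.prefix_grow _)

/-- The first vertex of the path of chosen children through a given vertex. -/
noncomputable def start (v : T.Vertex) : T.Vertex :=
  open Classical in
  if h : ∃ u, hT.grow u = v then start h.choose else v
termination_by v.1.length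
decreasing_by
  have h1 := hT.length_grow h.choose
  rw [h.choose_spec] at h1
  omega

theorem start_grow (u : T.Vertex) : hT.start (hT.grow u) = hT.start u := by
  have h : ∃ u', hT.grow u' = hT.grow u := ⟨u, rfl⟩
  rw [start, dif_pos h, hT.grow_injective h.choose_spec]

theorem start_iterate_grow (k : ℕ) (u : T.Vertex) : hT.start (hT.grow^[k] u) = hT.start u := by
  induction k with
  | zero => rfl
  | succ k ih => rw [Function.iterate_succ_apply', start_grow, ih]

theorem exists_iterate_grow_start (v : T.Vertex) : ∃ k, hT.grow^[k] (hT.start v) = v := by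
  induction h : v.1.length using Nat.strong_induction_on generalizing v with
  | _ n ih =>
    by_cases hv : ∃ u, hT.grow u = v
    · obtain ⟨u, rfl⟩ := hv
      rw [length_grow] at h
      obtain ⟨k, hk⟩ := ih u.1.length (by omega) u rfl
      exact ⟨k + 1, by rw [start_grow, Function.iterate_succ_apply', hk]⟩
    · exact ⟨0, by rw [start, dif_neg hv]; rfl⟩

theorem length_start_le (v : T.Vertex) : (hT.start v).1.length ≤ v.1.length := by
  obtain ⟨k, hk⟩ := hT.exists_iterate_grow_start v
  have := hT.length_iterate_grow k (hT.start v)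
  rw [hk] at this
  omega

theorem iterate_grow_start (v : T.Vertex) :
    hT.grow^[v.1.length - (hT.start v).1.length] (hT.start v) = v := by
  obtain ⟨k, hk⟩ := hT.exists_iterate_grow_start v
  have := hT.length_iterate_grow k (hT.start v)
  rw [hk] at this
  rwa [show v.1.length - (hT.start v).1.length = k by omega]

theorem start_start (v : T.Vertex) : hT.start (hT.start v) = hT.start v := by
  obtain ⟨k, hk⟩ := hT.exists_iterate_grow_start v
  conv_rhs => rw [← hk, start_iterate_grow]

/-- The first vertices of the paths that meet `Δ_n`. -/
def starts (n : ℕ) : Set T.Vertex := {s | hT.start s = s ∧ s.1.length ≤ n}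

theorem start_mem_starts {n : ℕ} {v : T.Vertex} (hv : v.1.length ≤ n) :
    hT.start v ∈ hT.starts n :=
  ⟨hT.start_start v, (hT.length_start_le v).trans hv⟩

noncomputable instance (n : ℕ) : Fintype (T.ball n) := (finite_ball n).fintype

noncomputable instance (n : ℕ) : Fintype (hT.starts n) :=
  ((finite_ball n).subset fun _ h => h.2).fintype

/-- `Δ_n` is the disjoint union of its paths of chosen children. -/
noncomputable def pathEquiv (n : ℕ) :
    -- The path from `s` meets each of the levels `|s|, …, n` once.
    (Σ s : hT.starts n, Fin (n + 1 - s.1.1.length)) ≃ T.ball n :=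
  Equiv.ofBijective (fun p => ⟨hT.grow^[p.2] p.1.1, by
      show (hT.grow^[p.2] p.1.1).1.length ≤ n
      have := p.2.2
      rw [length_iterate_grow]
      omega⟩) <| by
    constructor
    · rintro ⟨⟨s, hs⟩, j⟩ ⟨⟨s', hs'⟩, j'⟩ h
      have h' : hT.grow^[j] s = hT.grow^[j'] s' := congrArg Subtype.val h
      have hss : s = s' := by
        have := congrArg hT.start h'
        rwa [start_iterate_grow, start_iterate_grow, hs.1, hs'.1] at this
      subst hss
      have hl := congrArg (fun v : T.Vertex => v.1.length) h'
      simp only [length_iterate_grow] at hl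
      have : j = j' := Fin.ext (by omega)
      rw [this]
    · rintro ⟨v, hv⟩
      have hv' : v.1.length ≤ n := hv
      have := hT.length_start_le v
      exact ⟨⟨⟨hT.start v, hT.start_mem_starts hv⟩, ⟨v.1.length - (hT.start v).1.length,
        by dsimp only; omega⟩⟩, Subtype.ext (hT.iterate_grow_start v)⟩

theorem coe_pathEquiv {n : ℕ} (s : hT.starts n) (j : Fin (n + 1 - s.1.1.length)) :
    (hT.pathEquiv n ⟨s, j⟩ : T.Vertex) = hT.grow^[j] s.1 := rfl

theorem sum_ball {R : Type*} [AddCommMonoid R] (n : ℕ) (F : T.ball n → R) :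
    ∑ w, F w = ∑ s : hT.starts n, ∑ j, F (hT.pathEquiv n ⟨s, j⟩) := by
  rw [← (hT.pathEquiv n).sum_comp, Fintype.sum_sigma]

theorem ncard_ball_eq_sum (n : ℕ) :
    (T.ball n).ncard = ∑ s : hT.starts n, (n + 1 - s.1.1.length) := by
  rw [← Nat.card_coe_set_eq, Nat.card_eq_fintype_card, ← Fintype.card_congr (hT.pathEquiv n)]
  simp

end Leafless

/-! ### Growth of levels and balls, and averages over paths. -/

theorem finite_level (n : ℕ) : (T.level n).Finite :=
  (finite_ball n).subset fun _ h => le_of_eq h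

namespace Leafless

variable (hT : T.Leafless)

/-- Paths never end, so each one that meets `Δ_n` reaches level `n`, and disjoint paths do so at
different vertices. -/
theorem card_starts_le (n : ℕ) : Fintype.card (hT.starts n) ≤ (T.level n).ncard := by
  rw [← Nat.card_eq_fintype_card, Nat.card_coe_set_eq]
  refine Set.ncard_le_ncard_of_injOn (fun s => hT.grow^[n - s.1.length] s) ?_ ?_ (finite_level n)
  · rintro s ⟨-, hs⟩
    show (hT.grow^[n - s.1.length] s).1.length = n
    rw [length_iterate_grow]
    omega
  · rintro s ⟨hs, -⟩ s' ⟨hs', -⟩ h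
    have := congrArg hT.start h
    simpa only [start_iterate_grow, hs, hs'] using this

theorem ncard_level_le_add (hT : T.Leafless) (n k : ℕ) : (T.level n).ncard ≤ (T.level (n + k)).ncard := by
  refine Set.ncard_le_ncard_of_injOn (hT.grow^[k]) ?_ (hT.grow_injective.iterate k).injOn
    (finite_level _)
  intro v hv
  show (hT.grow^[k] v).1.length = n + k
  rw [length_iterate_grow, show v.1.length = n from hv]

theorem ncard_level_pos (hT : T.Leafless) (n : ℕ) : 0 < (T.level n).ncard := by
  have h := hT.ncard_level_le_add 0 n
  rw [zero_add] at h
  refine lt_of_lt_of_le ?_ h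
  exact (Set.ncard_pos (finite_level 0)).2 ⟨⟨[], T.nil_mem⟩, rfl⟩

end Leafless

theorem ncard_ball_succ (n : ℕ) :
    (T.ball (n + 1)).ncard = (T.ball n).ncard + (T.level (n + 1)).ncard := by
  rw [← Set.ncard_union_eq ?_ (finite_ball n) (finite_level (n + 1))]
  · congr 1
    ext v
    exact Nat.le_succ_iff
  · rw [Set.disjoint_left]
    intro v (h : v.1.length ≤ n) (h' : v.1.length = n + 1)
    omega

theorem ncard_ball_pos (n : ℕ) : 0 < (T.ball n).ncard :=
  (Set.ncard_pos (finite_ball n)).2 ⟨⟨[], T.nil_mem⟩, Nat.zero_le n⟩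

theorem Leafless.mul_ncard_level_le (hT : T.Leafless) (n k : ℕ) :
    k * (T.level n).ncard ≤ (T.ball (n + k)).ncard := by
  induction k with
  | zero => simp
  | succ k ih =>
    have h1 := ncard_ball_succ (T := T) (n + k)
    have h2 := hT.ncard_level_le_add n (k + 1)
    rw [← add_assoc] at h2 ⊢
    rw [h1, add_mul, one_mul]
    omega

namespace Unexpandable

theorem tendsto_level_add_div_level (hT : T.Leafless) (hU : T.Unexpandable) (k : ℕ) :
    Tendsto (fun n : ℕ => ((T.level (n + k)).ncard : ℝ) / ((T.level n).ncard : ℝ)) atTop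
      (𝓝 1) := by
  have hpos : ∀ n, ((T.level n).ncard : ℝ) ≠ 0 := fun n => by
    exact_mod_cast (hT.ncard_level_pos n).ne'
  induction k with
  | zero => simp [hpos]
  | succ k ih =>
    have h := (hU.comp (tendsto_add_atTop_nat k)).mul ih
    rw [one_mul] at h
    refine h.congr fun n => ?_
    show ((T.level (n + k + 1)).ncard : ℝ) / ((T.level (n + k)).ncard : ℝ) * _ = _
    rw [div_mul_div_cancel₀ (hpos _), add_assoc]

/-- The `k` levels after level `l` have at least `|T_l|` vertices each, while eventually `|T_{l+k}|
< 2 |T_l|`; so the ratio drops below `2 / k`. -/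
theorem tendsto_level_div_ball (hT : T.Leafless) (hU : T.Unexpandable) :
    Tendsto (fun n : ℕ => ((T.level n).ncard : ℝ) / ((T.ball n).ncard : ℝ)) atTop (𝓝 0) := by
  have hpos : ∀ n, (0 : ℝ) < (T.level n).ncard := fun n => by
    exact_mod_cast hT.ncard_level_pos n
  have hbpos : ∀ n, (0 : ℝ) < (T.ball n).ncard := fun n => by
    exact_mod_cast ncard_ball_pos n
  rw [Metric.tendsto_atTop]
  intro ε hε
  obtain ⟨k, hk⟩ := exists_nat_gt (2 / ε)
  have hk0 : (0 : ℝ) < k := lt_trans (by positivity) hk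
  obtain ⟨N, hN⟩ := eventually_atTop.1
    ((tendsto_order.1 (tendsto_level_add_div_level hT hU k)).2 2 (by norm_num))
  refine ⟨N + k, fun n hn => ?_⟩
  obtain ⟨l, rfl⟩ : ∃ l, n = l + k := ⟨n - k, by omega⟩
  rw [Real.dist_eq, sub_zero, abs_of_nonneg (by positivity), div_lt_iff₀ (hbpos _)]
  have h1 := hN l (by omega)
  rw [div_lt_iff₀ (hpos _)] at h1
  have h2 : (k : ℝ) * (T.level l).ncard ≤ (T.ball (l + k)).ncard := by
    exact_mod_cast hT.mul_ncard_level_le l k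
  rw [div_lt_iff₀ hε] at hk
  calc ((T.level (l + k)).ncard : ℝ) < 2 * (T.level l).ncard := h1
    _ ≤ (k * ε) * (T.level l).ncard := by gcongr
    _ = ε * (k * (T.level l).ncard) := by ring
    _ ≤ ε * (T.ball (l + k)).ncard := by gcongr

theorem tendsto_ball_add_div_ball (hT : T.Leafless) (hU : T.Unexpandable) (k : ℕ) :
    Tendsto (fun n : ℕ => ((T.ball (n + k)).ncard : ℝ) / ((T.ball n).ncard : ℝ)) atTop (𝓝 1) := by
  have hpos : ∀ n, ((T.level n).ncard : ℝ) ≠ 0 := fun n => by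
    exact_mod_cast (hT.ncard_level_pos n).ne'
  have hbpos : ∀ n, ((T.ball n).ncard : ℝ) ≠ 0 := fun n => by
    exact_mod_cast (ncard_ball_pos n).ne'
  have hsucc : Tendsto (fun n : ℕ => ((T.ball (n + 1)).ncard : ℝ) / ((T.ball n).ncard : ℝ)) atTop
      (𝓝 1) := by
    have h := (Tendsto.mul hU (tendsto_level_div_ball hT hU)).const_add 1
    rw [mul_zero, add_zero] at h
    refine h.congr fun n => ?_
    rw [div_mul_div_cancel₀ (hpos _), ncard_ball_succ, Nat.cast_add, add_div, div_self (hbpos n)]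
  induction k with
  | zero => simp [hbpos]
  | succ k ih =>
    have h := (hsucc.comp (tendsto_add_atTop_nat k)).mul ih
    rw [one_mul] at h
    refine h.congr fun n => ?_
    show ((T.ball (n + k + 1)).ncard : ℝ) / ((T.ball (n + k)).ncard : ℝ) * _ = _
    rw [div_mul_div_cancel₀ (hbpos _), add_assoc]

end Unexpandable

/-- The constant absorbs the finitely many small `k`, so that short path segments can be treated
together with the long ones. -/
theorem exists_abs_sub_le_of_tendsto_div {f : ℕ → ℝ} {a ε : ℝ} (hε : 0 < ε)
    (hf : Tendsto (fun n : ℕ => f n / n) atTop (𝓝 a)) :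
    ∃ C, 0 ≤ C ∧ ∀ k : ℕ, |f k - a * k| ≤ ε * k + C := by
  obtain ⟨N, hN⟩ := Metric.tendsto_atTop.1 hf ε hε
  refine ⟨∑ k ∈ Finset.range (N + 1), |f k - a * k|, Finset.sum_nonneg fun _ _ => abs_nonneg _,
    fun k => ?_⟩
  rcases le_or_gt k N with hk | hk
  · have := Finset.single_le_sum (f := fun k : ℕ => |f k - a * k|) (fun _ _ => abs_nonneg _)
      (Finset.mem_range.2 (Nat.lt_succ_of_le hk))
    have h2 : 0 ≤ ε * k := by positivity
    linarith
  · have hk0 : (0 : ℝ) < k := by exact_mod_cast (Nat.zero_le N).trans_lt hk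
    have h := hN k hk.le
    rw [Real.dist_eq, show f k / k - a = (f k - a * k) / k by field_simp, abs_div,
      abs_of_pos hk0, div_lt_iff₀ hk0] at h
    have : 0 ≤ ∑ k ∈ Finset.range (N + 1), |f k - a * k| :=
      Finset.sum_nonneg fun _ _ => abs_nonneg _
    linarith

/-- Averages along the paths decomposing `Δ_n` converge to averages over `Δ_n`. -/
theorem Unexpandable.tendsto_sum_starts_div_ball (hT : T.Leafless) (hU : T.Unexpandable)
    {f : ℕ → ℝ} {a : ℝ} (hf : Tendsto (fun n : ℕ => f n / n) atTop (𝓝 a)) :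
    Tendsto (fun n : ℕ => (∑ s : hT.starts n, f (n + 1 - s.1.1.length)) /
      ((T.ball n).ncard : ℝ)) atTop (𝓝 a) := by
  rw [Metric.tendsto_atTop]
  intro ε hε
  obtain ⟨C, hC, hfC⟩ := exists_abs_sub_le_of_tendsto_div (half_pos hε) hf
  have hlim := (tendsto_level_div_ball hT hU).const_mul C
  rw [mul_zero] at hlim
  obtain ⟨N, hN⟩ := eventually_atTop.1 ((tendsto_order.1 hlim).2 (ε / 2) (half_pos hε))
  refine ⟨N, fun n hn => ?_⟩
  have hb : (0 : ℝ) < (T.ball n).ncard := by exact_mod_cast ncard_ball_pos n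
  have hsum : ((T.ball n).ncard : ℝ) = ∑ s : hT.starts n, ((n + 1 - s.1.1.length : ℕ) : ℝ) := by
    rw [hT.ncard_ball_eq_sum, Nat.cast_sum]
  -- The constant `C` is paid once per path, hence at most `|T_n|` times, which is negligible
  -- against `|Δ_n|`.
  have h1 : |∑ s : hT.starts n, f (n + 1 - s.1.1.length) - a * (T.ball n).ncard| ≤
      ε / 2 * (T.ball n).ncard + C * (T.level n).ncard := by
    calc _ = |∑ s : hT.starts n,
          (f (n + 1 - s.1.1.length) - a * ((n + 1 - s.1.1.length : ℕ) : ℝ))| := by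
          rw [Finset.sum_sub_distrib, ← Finset.mul_sum, ← hsum]
      _ ≤ ∑ s : hT.starts n, (ε / 2 * ((n + 1 - s.1.1.length : ℕ) : ℝ) + C) :=
          (Finset.abs_sum_le_sum_abs _ _).trans (Finset.sum_le_sum fun s _ => hfC _)
      _ = ε / 2 * (T.ball n).ncard + Fintype.card (hT.starts n) * C := by
          rw [Finset.sum_add_distrib, ← Finset.mul_sum, ← hsum]
          simp
      _ ≤ _ := by
          have : (Fintype.card (hT.starts n) : ℝ) ≤ (T.level n).ncard := by
            exact_mod_cast hT.card_starts_le n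
          rw [mul_comm C]
          gcongr
  have h2 := hN n hn
  rw [← mul_div_assoc, div_lt_iff₀ hb] at h2
  rw [Real.dist_eq, show (∑ s : hT.starts n, f (n + 1 - s.1.1.length)) / ((T.ball n).ncard : ℝ) - a
    = (∑ s : hT.starts n, f (n + 1 - s.1.1.length) - a * (T.ball n).ncard) / (T.ball n).ncard by
      field_simp, abs_div, abs_of_pos hb, div_lt_iff₀ hb]
  linarith

/-! ### Rays -/

/-- The ray runs through the prefixes of `s` and then along chosen children. Labels on the path from
`s` are therefore read in a point of `X` from position `|s|` on. -/
theorem Leafless.exists_ray (hT : T.Leafless) (s : T.Vertex) :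
    ∃ ρ, T.IsRay ρ ∧ ∀ j, ρ (s.1.length + j) = hT.grow^[j] s := by
  refine ⟨fun i => if i < s.1.length then ⟨s.1.take i, take_mem_carrier s.2 i⟩
    else hT.grow^[i - s.1.length] s, ⟨?_, fun n => ?_⟩, fun j => ?_⟩
  · by_cases h : 0 < s.1.length
    · simp [h]
    · have h0 : s.1 = [] := by simpa using h
      simp [h0]
  · dsimp only
    rcases lt_trichotomy (n + 1) s.1.length with h | h | h
    · refine ⟨s.1[n], ?_⟩
      rw [if_pos h, if_pos (by omega)]
      exact (List.take_concat_get' s.1 n (by omega)).symm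
    · refine ⟨s.1[n], ?_⟩
      rw [if_neg (by omega), if_pos (by omega), h, Nat.sub_self]
      show s.1 = s.1.take n ++ [s.1[n]]
      rw [List.take_concat_get' s.1 n (by omega), h, List.take_length]
    · rw [if_neg (by omega), if_neg (by omega), show n + 1 - s.1.length = n - s.1.length + 1 by
        omega, Function.iterate_succ_apply']
      exact ⟨_, rfl⟩
  · simp

theorem Leafless.nonempty_of_mem_treeShift (hT : T.Leafless) {m : ℕ} {X : Set (ℕ → Fin m)}
    {t : T.Vertex → Fin m} (ht : t ∈ T.treeShift X) : X.Nonempty :=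
  let ⟨_, hρ, _⟩ := hT.exists_ray ⟨[], T.nil_mem⟩
  ⟨_, ht _ hρ⟩

theorem IsRay.length {ρ : ℕ → T.Vertex} (hρ : T.IsRay ρ) (n : ℕ) : (ρ n).1.length = n := by
  induction n with
  | zero => simp [hρ.1]
  | succ n ih =>
    obtain ⟨a, ha⟩ := hρ.2 n
    simp [ha, ih]

/-! ### Labellings of `Δ_n` along paths -/

section Patterns

variable (hT : T.Leafless) {m : ℕ}

/-- The labellings of `Δ_n` that are admissible along each of the paths decomposing `Δ_n`. -/
def pathPatterns (X : Set (ℕ → Fin m)) (n : ℕ) : Set (T.ball n → Fin m) :=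
  {q | ∀ s : hT.starts n, (fun j => q (hT.pathEquiv n ⟨s, j⟩)) ∈
    blocksAt X s.1.1.length (n + 1 - s.1.1.length)}

theorem ncard_pathPatterns (X : Set (ℕ → Fin m)) (n : ℕ) :
    (pathPatterns hT X n).ncard =
      ∏ s : hT.starts n, (blocksAt X s.1.1.length (n + 1 - s.1.1.length)).ncard := by
  let e : (T.ball n → Fin m) ≃ ∀ s : hT.starts n, Fin (n + 1 - s.1.1.length) → Fin m :=
    (Equiv.arrowCongr (hT.pathEquiv n).symm (Equiv.refl _)).trans
      (Equiv.piCurry fun _ _ => Fin m)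
  have e' : pathPatterns hT X n ≃
      ∀ s : hT.starts n, blocksAt X s.1.1.length (n + 1 - s.1.1.length) :=
    (e.subtypeEquiv (q := fun f => ∀ s, f s ∈ blocksAt X s.1.1.length (n + 1 - s.1.1.length))
      fun q => Iff.rfl).trans Equiv.subtypePiEquivPi
  rw [← Nat.card_coe_set_eq, Nat.card_congr e', Nat.card_pi]
  simp only [Nat.card_coe_set_eq]

theorem patterns_subset_pathPatterns (X : Set (ℕ → Fin m)) (n : ℕ) :
    patterns (T.treeShift X) n ⊆ pathPatterns hT X n := by
  rintro _ ⟨t, ht, rfl⟩ s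
  obtain ⟨ρ, hρ, h⟩ := hT.exists_ray s.1
  exact ⟨_, ht ρ hρ, fun j => by rw [h]; rfl⟩

theorem patterns_nonempty {𝒯 : Set (T.Vertex → Fin m)} (h : 𝒯.Nonempty) (n : ℕ) :
    (patterns 𝒯 n).Nonempty := h.image _

theorem log_ncard_pathPatterns {X : Set (ℕ → Fin m)} (hne : X.Nonempty) (n : ℕ) :
    Real.log ((pathPatterns hT X n).ncard : ℝ) = ∑ s : hT.starts n,
      Real.log ((blocksAt X s.1.1.length (n + 1 - s.1.1.length)).ncard : ℝ) := by
  rw [ncard_pathPatterns, Nat.cast_prod, Real.log_prod]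
  intro s _
  exact_mod_cast (blocksAt_ncard_pos hne _ _).ne'

theorem log_ncard_pathPatterns_le {X : Set (ℕ → Fin m)} (hne : X.Nonempty) (n : ℕ) :
    Real.log ((pathPatterns hT X n).ncard : ℝ) ≤ ∑ s : hT.starts n,
      Real.log ((blocks X (n + 1 - s.1.1.length)).ncard : ℝ) := by
  rw [log_ncard_pathPatterns hT hne]
  refine Finset.sum_le_sum fun s _ => Real.log_le_log ?_ ?_
  · exact_mod_cast blocksAt_ncard_pos hne _ _
  · exact_mod_cast Set.ncard_le_ncard (blocksAt_subset_blocks _ _)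

theorem entropy_mul_le_log_pathPatterns {X : Set (ℕ → Fin m)} (hX : IsShift X) (hne : X.Nonempty)
    (n : ℕ) : entropy X * (T.ball n).ncard ≤ Real.log ((pathPatterns hT X n).ncard : ℝ) := by
  rw [log_ncard_pathPatterns hT hne, hT.ncard_ball_eq_sum, Nat.cast_sum, Finset.mul_sum]
  exact Finset.sum_le_sum fun s _ => hX.entropy_mul_le_log_blocksAt hne _ _

theorem log_ncard_patterns_le {X : Set (ℕ → Fin m)} (hne : (T.treeShift X).Nonempty) (n : ℕ) :
    Real.log ((patterns (T.treeShift X) n).ncard : ℝ) ≤ ∑ s : hT.starts n,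
      Real.log ((blocks X (n + 1 - s.1.1.length)).ncard : ℝ) := by
  obtain ⟨t, ht⟩ := hne
  refine le_trans (Real.log_le_log ?_ ?_)
    (log_ncard_pathPatterns_le hT (hT.nonempty_of_mem_treeShift ht) n)
  · exact_mod_cast (Set.ncard_pos (Set.toFinite _)).2 (patterns_nonempty ⟨t, ht⟩ n)
  · exact_mod_cast Set.ncard_le_ncard (patterns_subset_pathPatterns hT X n)

end Patterns

/-! ### Patterns forced by an independence set. -/

theorem IsIndependenceSet.nonempty {m : ℕ} [NeZero m] {𝒯 : Set (T.Vertex → Fin m)}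
    {S : Set T.Vertex} (hS : IsIndependenceSet 𝒯 S) : 𝒯.Nonempty :=
  let ⟨t, ht, _⟩ := hS fun _ => 0
  ⟨t, ht⟩

theorem IsIndependenceSet.pow_ncard_le {m : ℕ} [NeZero m] {𝒯 : Set (T.Vertex → Fin m)}
    {S : Set T.Vertex} (hS : IsIndependenceSet 𝒯 S) (n : ℕ) :
    m ^ (S ∩ T.ball n).ncard ≤ (patterns 𝒯 n).ncard := by
  classical
  have hfin : (S ∩ T.ball n).Finite := (finite_ball n).inter_of_right S
  have := hfin.fintype
  have hcard : m ^ (S ∩ T.ball n).ncard = Nat.card (↥(S ∩ T.ball n) → Fin m) := by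
    rw [Nat.card_fun, Nat.card_coe_set_eq, Nat.card_fin]
  -- Labels on `S` outside `Δ_n` are set to `0`; only those inside distinguish the patterns.
  choose t ht htS using fun u : ↥(S ∩ T.ball n) → Fin m =>
    hS fun g => if h : g.1 ∈ S ∩ T.ball n then u ⟨g.1, h⟩ else 0
  rw [hcard, ← Nat.card_coe_set_eq]
  refine Nat.card_le_card_of_injective
    (fun u => (⟨(T.ball n).domRestrict (t u), t u, ht u, rfl⟩ : patterns 𝒯 n)) ?_
  intro u v huv
  funext g
  have h1 := htS u ⟨g.1, g.2.1⟩
  have h2 := htS v ⟨g.1, g.2.1⟩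
  rw [dif_pos g.2] at h1 h2
  have h3 : t u g.1 = t v g.1 := congrFun (congrArg Subtype.val huv) ⟨g.1, g.2.2⟩
  exact h1.symm.trans (h3.trans h2)

theorem IsIndependenceSet.mul_log_le {m : ℕ} [NeZero m] {𝒯 : Set (T.Vertex → Fin m)}
    {S : Set T.Vertex} (hS : IsIndependenceSet 𝒯 S) (n : ℕ) :
    (S ∩ T.ball n).ncard * Real.log m ≤ Real.log ((patterns 𝒯 n).ncard : ℝ) := by
  rw [← Real.log_pow]
  have hm : (0 : ℝ) < m := by exact_mod_cast Nat.pos_of_neZero m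
  exact Real.log_le_log (by positivity) (by exact_mod_cast hS.pow_ncard_le n)

end TreeShift.WordTree

namespace TreeShift.WordTree

variable {α : Type*} {T : WordTree α}

/-! ### Vertices without branching below them -/

variable (T) in
/-- The vertices below which the tree does not branch. -/
def thin : Set T.Vertex :=
  {v | ∀ w₁ w₂ : T.Vertex, v.1 <+: w₁.1 → v.1 <+: w₂.1 → w₁.1.length = w₂.1.length → w₁ = w₂}

theorem thin_of_prefix {v w : T.Vertex} (hv : v ∈ T.thin) (h : v.1 <+: w.1) : w ∈ T.thin :=
  fun w₁ w₂ h₁ h₂ => hv w₁ w₂ (h.trans h₁) (h.trans h₂)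

/-- Consequently a ray that has reached a thin vertex follows chosen children and stays on one path.
-/
theorem Leafless.eq_grow_of_thin (hT : T.Leafless) {v w : T.Vertex} (hv : v ∈ T.thin) {a : α}
    (h : w.1 = v.1 ++ [a]) : w = hT.grow v :=
  hv w _ (h ▸ List.prefix_append _ _) (hT.prefix_grow v) (by rw [h, hT.length_grow]; simp)

theorem eq_of_prefix {v v' w : T.Vertex} (h : v.1 <+: w.1) (h' : v'.1 <+: w.1)
    (hl : v.1.length = v'.1.length) : v = v' :=
  Subtype.ext ((List.prefix_of_prefix_length_le h h' hl.le).eq_of_length hl)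

/-- If the tree branches within a bounded distance from each vertex that is not thin, then the
vertices that are not thin are counted by the growth of the balls. -/
theorem Leafless.ncard_ball_diff_thin_add_le (hT : T.Leafless) {K : ℕ}
    (hK : ∀ v ∉ T.thin, ∃ w₁ w₂ : T.Vertex, v.1 <+: w₁.1 ∧ v.1 <+: w₂.1 ∧
      w₁.1.length = v.1.length + K ∧ w₂.1.length = v.1.length + K ∧ w₁ ≠ w₂) (n : ℕ) :
    (T.ball n \ T.thin).ncard + (T.ball n).ncard ≤ (T.ball (n + K)).ncard := by
  -- Each non-thin `v` gets a second descendant `K` levels down, besides `hT.grow^[K] v`. A vertex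
  -- determines its ancestor `K` levels up, so all these descendants are distinct.
  have hψ : ∀ v, ∃ w : T.Vertex, v ∉ T.thin →
      v.1 <+: w.1 ∧ w.1.length = v.1.length + K ∧ w ≠ hT.grow^[K] v := by
    intro v
    by_cases hv : v ∈ T.thin
    · exact ⟨v, fun h => absurd hv h⟩
    · obtain ⟨w₁, w₂, h₁, h₂, l₁, l₂, hne⟩ := hK v hv
      by_cases h : w₁ = hT.grow^[K] v
      · exact ⟨w₂, fun _ => ⟨h₂, l₂, fun h' => hne (h.trans h'.symm)⟩⟩
      · exact ⟨w₁, fun _ => ⟨h₁, l₁, h⟩⟩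
  choose ψ hψ using hψ
  have h1 : (ψ '' (T.ball n \ T.thin)).ncard = (T.ball n \ T.thin).ncard := by
    refine Set.InjOn.ncard_image ?_
    intro v hv v' hv' h
    have h1 := hψ v hv.2
    have h2 := hψ v' hv'.2
    have : v.1.length = v'.1.length := by
      have := h ▸ h1.2.1
      omega
    exact eq_of_prefix h1.1 (h ▸ h2.1) this
  have h2 : (hT.grow^[K] '' T.ball n).ncard = (T.ball n).ncard :=
    Set.ncard_image_of_injective _ (hT.grow_injective.iterate K)
  rw [← h1, ← h2, ← Set.ncard_union_eq ?_ (((finite_ball n).sdiff).image _)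
    ((finite_ball n).image _)]
  · refine Set.ncard_le_ncard ?_ (finite_ball _)
    rintro _ (⟨v, hv, rfl⟩ | ⟨v, hv, rfl⟩)
    · have hl : v.1.length ≤ n := hv.1
      show (ψ v).1.length ≤ n + K
      rw [(hψ v hv.2).2.1]
      omega
    · have hl : v.1.length ≤ n := hv
      show (hT.grow^[K] v).1.length ≤ n + K
      rw [hT.length_iterate_grow]
      omega
  · rw [Set.disjoint_left]
    rintro _ ⟨v, hv, rfl⟩ ⟨v', hv', h⟩
    have h1 := hψ v hv.2
    have hl : v.1.length = v'.1.length := by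
      have h2 := h1.2.1
      rw [← h, hT.length_iterate_grow] at h2
      omega
    have : v = v' := eq_of_prefix h1.1 (h ▸ hT.prefix_iterate_grow K v') hl
    subst this
    exact h1.2.2 h.symm

theorem Unexpandable.tendsto_ball_diff_thin (hT : T.Leafless) (hU : T.Unexpandable) {K : ℕ}
    (hK : ∀ v ∉ T.thin, ∃ w₁ w₂ : T.Vertex, v.1 <+: w₁.1 ∧ v.1 <+: w₂.1 ∧
      w₁.1.length = v.1.length + K ∧ w₂.1.length = v.1.length + K ∧ w₁ ≠ w₂) :
    Tendsto (fun n : ℕ => ((T.ball n \ T.thin).ncard : ℝ) / ((T.ball n).ncard : ℝ)) atTop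
      (𝓝 0) := by
  have h := (tendsto_ball_add_div_ball hT hU K).sub_const 1
  rw [sub_self] at h
  refine squeeze_zero (fun n => by positivity) (fun n => ?_) h
  have hb : (0 : ℝ) < (T.ball n).ncard := by exact_mod_cast ncard_ball_pos n
  have := hT.ncard_ball_diff_thin_add_le hK n
  have h' : ((T.ball n \ T.thin).ncard : ℝ) + (T.ball n).ncard ≤ (T.ball (n + K)).ncard := by
    exact_mod_cast this
  rw [le_sub_iff_add_le, ← div_self hb.ne', ← add_div]
  gcongr

/-! ### Hereditary shifts -/

/-- A labelling that vanishes off the thin vertices and is dominated along each path by a point of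
the hereditary shift `X` belongs to the tree-shift. -/
theorem mem_treeShift_of_hereditary (hT : T.Leafless) {m : ℕ} [NeZero m] {X : Set (ℕ → Fin m)}
    (hX : IsHereditary X) (hne : X.Nonempty) {t : T.Vertex → Fin m}
    (h0 : ∀ w ∉ T.thin, t w = 0)
    (ht : ∀ s, ∃ y ∈ X, ∀ w ∈ T.thin, hT.start w = s → t w ≤ y w.1.length) :
    t ∈ T.treeShift X := by
  classical
  intro ρ hρ
  by_cases hex : ∃ n, ρ n ∈ T.thin
  · have hspec := Nat.find_spec hex
    -- The point attached to the path of the first thin vertex dominates the whole ray: earlier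
    -- labels are `0`, later vertices stay on that path.
    obtain ⟨y, hy, hyt⟩ := ht (hT.start (ρ (Nat.find hex)))
    have hρn : ∀ k, ρ (Nat.find hex + k) ∈ T.thin ∧
        hT.start (ρ (Nat.find hex + k)) = hT.start (ρ (Nat.find hex)) := by
      intro k
      induction k with
      | zero => exact ⟨hspec, rfl⟩
      | succ k ih =>
        obtain ⟨a, ha⟩ := hρ.2 (Nat.find hex + k)
        rw [← add_assoc]
        refine ⟨thin_of_prefix ih.1 (ha ▸ List.prefix_append _ _), ?_⟩
        rw [hT.eq_grow_of_thin ih.1 ha, hT.start_grow, ih.2]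
    refine hX y hy _ fun n => ?_
    rcases lt_or_ge n (Nat.find hex) with hn | hn
    · rw [h0 _ (Nat.find_min hex hn)]
      exact Fin.zero_le _
    · obtain ⟨k, rfl⟩ := Nat.exists_eq_add_of_le hn
      have := hyt _ (hρn k).1 (hρn k).2
      rwa [hρ.length] at this
  · obtain ⟨x, hx⟩ := hne
    refine hX x hx _ fun n => ?_
    rw [h0 _ fun h => hex ⟨n, h⟩]
    exact Fin.zero_le _

theorem restrict_thin_mem_patterns (hT : T.Leafless) {m : ℕ} [NeZero m] {X : Set (ℕ → Fin m)}
    (hX : IsHereditary X) (hne : X.Nonempty) {n : ℕ} {q : T.ball n → Fin m}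
    (hq : q ∈ pathPatterns hT X n) :
    open Classical in
    (fun w : T.ball n => if w.1 ∈ T.thin then q w else 0) ∈ patterns (T.treeShift X) n := by
  classical
  have hy : ∀ s : T.Vertex, ∃ y ∈ X, ∀ hs : s ∈ hT.starts n,
      ∀ j : Fin (n + 1 - s.1.length), q (hT.pathEquiv n ⟨⟨s, hs⟩, j⟩) = y (s.1.length + j) := by
    intro s
    by_cases hs : s ∈ hT.starts n
    · obtain ⟨y, hy, h⟩ := hq ⟨s, hs⟩
      exact ⟨y, hy, fun _ j => h j⟩
    · obtain ⟨y, hy⟩ := hne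
      exact ⟨y, hy, fun h => absurd h hs⟩
  choose y hyX hyq using hy
  refine ⟨fun w => if w ∈ T.thin then y (hT.start w) w.1.length else 0,
    mem_treeShift_of_hereditary hT hX hne (fun w hw => if_neg hw) fun s => ⟨y s, hyX s, ?_⟩, ?_⟩
  · rintro w hw rfl
    rw [if_pos hw]
  · funext w
    show (if w.1 ∈ T.thin then y (hT.start w.1) w.1.1.length else 0) = _
    by_cases hw : w.1 ∈ T.thin
    · rw [if_pos hw, if_pos hw]
      obtain ⟨⟨s, j⟩, rfl⟩ := (hT.pathEquiv n).surjective w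
      rw [hyq s.1 s.2 j, hT.coe_pathEquiv, hT.start_iterate_grow, s.2.1, hT.length_iterate_grow]
    · rw [if_neg hw, if_neg hw]

/-- Erasing the labels at non-thin vertices turns a path-wise admissible labelling into a genuine
pattern; the second factor counts the erased labels. -/
theorem ncard_pathPatterns_le (hT : T.Leafless) {m : ℕ} [NeZero m] {X : Set (ℕ → Fin m)}
    (hX : IsHereditary X) (hne : X.Nonempty) (n : ℕ) :
    (pathPatterns hT X n).ncard ≤
      (patterns (T.treeShift X) n).ncard * m ^ (T.ball n \ T.thin).ncard := by
  classical
  have hfin : (T.ball n \ T.thin).Finite := (finite_ball n).sdiff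
  have := hfin.fintype
  have hcard : m ^ (T.ball n \ T.thin).ncard =
      (Set.univ : Set (↥(T.ball n \ T.thin) → Fin m)).ncard := by
    rw [Set.ncard_univ, Nat.card_fun, Nat.card_coe_set_eq, Nat.card_fin]
  rw [hcard, ← Set.ncard_prod]
  refine Set.ncard_le_ncard_of_injOn
    (fun q => (fun w : T.ball n => if w.1 ∈ T.thin then q w else 0, fun w => q ⟨w.1, w.2.1⟩))
    (fun q hq => ⟨restrict_thin_mem_patterns hT hX hne hq, Set.mem_univ _⟩) ?_ (Set.toFinite _)
  intro q _ q' _ h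
  simp only [Prod.mk.injEq] at h
  funext w
  by_cases hw : w.1 ∈ T.thin
  · simpa [hw] using congrFun h.1 w
  · exact congrFun h.2 ⟨w.1, w.2, hw⟩

theorem treeShift_nonempty {m : ℕ} [NeZero m] {X : Set (ℕ → Fin m)}
    (hX : IsHereditary X) (hne : X.Nonempty) : (T.treeShift X).Nonempty := by
  obtain ⟨x, hx⟩ := hne
  exact ⟨fun _ => 0, fun ρ _ => hX x hx _ fun n => Fin.zero_le _⟩

theorem tendsto_treeEntropy (hT : T.Leafless) (hU : T.Unexpandable)
    (hthin : Tendsto (fun n : ℕ => ((T.ball n \ T.thin).ncard : ℝ) / ((T.ball n).ncard : ℝ)) atTop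
      (𝓝 0)) {m : ℕ} [NeZero m] {X : Set (ℕ → Fin m)} (hX : IsShift X) (hXh : IsHereditary X)
    (hne : X.Nonempty) :
    Tendsto (fun n : ℕ => Real.log ((patterns (T.treeShift X) n).ncard : ℝ) /
      ((T.ball n).ncard : ℝ)) atTop (𝓝 (entropy X)) := by
  have hlow := (hthin.mul_const (Real.log m)).const_sub (entropy X)
  rw [zero_mul, sub_zero] at hlow
  refine tendsto_of_tendsto_of_tendsto_of_le_of_le hlow
    (hU.tendsto_sum_starts_div_ball hT (tendsto_entropy X)) (fun n => ?_) (fun n => ?_)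
  · have hb : (0 : ℝ) < (T.ball n).ncard := by exact_mod_cast ncard_ball_pos n
    have hm : (0 : ℝ) < m := by exact_mod_cast Nat.pos_of_neZero m
    have hP : (0 : ℝ) < (patterns (T.treeShift X) n).ncard := by
      exact_mod_cast (Set.ncard_pos (Set.toFinite _)).2
        (patterns_nonempty (treeShift_nonempty hXh hne) n)
    have hQ : (0 : ℝ) < (pathPatterns hT X n).ncard := by
      rw [ncard_pathPatterns]
      exact_mod_cast Finset.prod_pos fun s _ => blocksAt_ncard_pos hne _ _
    have h1 := entropy_mul_le_log_pathPatterns hT hX hne n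
    have h2 : Real.log ((pathPatterns hT X n).ncard : ℝ) ≤
        Real.log ((patterns (T.treeShift X) n).ncard : ℝ) +
          (T.ball n \ T.thin).ncard * Real.log m := by
      rw [← Real.log_pow, ← Real.log_mul hP.ne' (by positivity)]
      exact Real.log_le_log hQ (by exact_mod_cast ncard_pathPatterns_le hT hXh hne n)
    rw [le_div_iff₀ hb, sub_mul, div_mul_eq_mul_div, div_mul_cancel₀ _ hb.ne']
    linarith
  · gcongr
    exact log_ncard_patterns_le hT (treeShift_nonempty hXh hne) n

theorem treeEntropy_eq_entropy (hT : T.Leafless) (hU : T.Unexpandable)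
    (hthin : Tendsto (fun n : ℕ => ((T.ball n \ T.thin).ncard : ℝ) / ((T.ball n).ncard : ℝ)) atTop
      (𝓝 0)) {m : ℕ} [NeZero m] {X : Set (ℕ → Fin m)} (hX : IsShift X) (hXh : IsHereditary X) :
    treeEntropy (T.treeShift X) = entropy X := by
  rcases X.eq_empty_or_nonempty with rfl | hne
  -- A leafless tree has a ray, so the tree-shift is empty too, and both entropies are `0` by the
  -- convention `log 0 = 0`.
  · have h : T.treeShift (∅ : Set (ℕ → Fin m)) = ∅ :=
      Set.eq_empty_of_forall_notMem fun t ht => by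
        simpa using hT.nonempty_of_mem_treeShift ht
    simp [h, treeEntropy, entropy, patterns, blocks]
  · exact (tendsto_treeEntropy hT hU hthin hX hXh hne).limsup_eq

/-! ### Independence sets -/

theorem hasDensity_zero_of_entropy_eq_zero (hT : T.Leafless) (hU : T.Unexpandable) {m : ℕ}
    (hm : 2 ≤ m) {X : Set (ℕ → Fin m)} (h0 : entropy X = 0) {S : Set T.Vertex}
    (hS : IsIndependenceSet (T.treeShift X) S) : HasDensity S 0 := by
  have : NeZero m := ⟨by omega⟩
  have hlog : 0 < Real.log m := Real.log_pos (by exact_mod_cast hm)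
  have h := (hU.tendsto_sum_starts_div_ball hT (h0 ▸ tendsto_entropy X)).div_const (Real.log m)
  rw [zero_div] at h
  refine squeeze_zero (fun n => by positivity) (fun n => ?_) h
  rw [le_div_iff₀ hlog, div_mul_eq_mul_div]
  gcongr
  exact (hS.mul_log_le n).trans (log_ncard_patterns_le hT hS.nonempty n)

theorem upperDensity_mul_log_le (hT : T.Leafless) (hU : T.Unexpandable) {m : ℕ} (hm : 2 ≤ m)
    {X : Set (ℕ → Fin m)} {S : Set T.Vertex} (hS : IsIndependenceSet (T.treeShift X) S) :
    upperDensity S * Real.log m ≤ entropy X := by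
  have : NeZero m := ⟨by omega⟩
  have hlog : 0 < Real.log m := Real.log_pos (by exact_mod_cast hm)
  have h := (hU.tendsto_sum_starts_div_ball hT (tendsto_entropy X)).div_const (Real.log m)
  rw [← le_div_iff₀ hlog, ← h.limsup_eq]
  refine limsup_le_limsup (Eventually.of_forall fun n => ?_)
    (isCoboundedUnder_le_of_le atTop (x := 0) fun n => by positivity) h.isBoundedUnder_le
  rw [le_div_iff₀ hlog, div_mul_eq_mul_div]
  gcongr
  exact (hS.mul_log_le n).trans (log_ncard_patterns_le hT hS.nonempty n)

theorem HasDensity.upperDensity_eq {S : Set T.Vertex} {δ : ℝ} (h : HasDensity S δ) :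
    upperDensity S = δ :=
  h.limsup_eq

theorem sum_ite_eq_count (p : ℕ → Prop) [DecidablePred p] (n : ℕ) :
    ∑ j : Fin n, (if p j then 1 else 0) = Nat.count p n := by
  rw [Nat.count_eq_card_filter_range, Finset.card_filter,
    Finset.sum_range fun i => if p i then 1 else 0]

/-- Copying a set of integers to each of the paths preserves the density. -/
theorem hasDensity_of_tendsto_count (hT : T.Leafless) (hU : T.Unexpandable) (p : ℕ → Prop)
    [DecidablePred p] {A : ℝ}
    (hp : Tendsto (fun n : ℕ => (Nat.count p n : ℝ) / n) atTop (𝓝 A)) :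
    HasDensity {w : T.Vertex | p (w.1.length - (hT.start w).1.length)} A := by
  refine (hU.tendsto_sum_starts_div_ball hT hp).congr fun n => ?_
  congr 1
  rw [← Nat.cast_sum]
  congr 1
  let F : T.ball n → ℕ := fun w =>
    if p (w.1.1.length - (hT.start w.1).1.length) then 1 else 0
  have hF : ∀ s : hT.starts n, Nat.count p (n + 1 - s.1.1.length) =
      ∑ j, F (hT.pathEquiv n ⟨s, j⟩) := by
    intro s
    rw [← sum_ite_eq_count]
    refine Finset.sum_congr rfl fun j _ => ?_
    simp only [F, hT.coe_pathEquiv, hT.start_iterate_grow, s.2.1, hT.length_iterate_grow,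
      Nat.add_sub_cancel_left]
  rw [Finset.sum_congr rfl fun s _ => hF s, ← hT.sum_ball n F, ← Finset.card_filter,
    ← Set.ncard_coe_finset, ← Set.ncard_image_of_injective _ Subtype.val_injective]
  congr 1
  ext w
  constructor
  · rintro ⟨v, hv, rfl⟩
    exact ⟨by simpa using hv, v.2⟩
  · rintro ⟨hw, hwn⟩
    exact ⟨⟨w, hwn⟩, by simpa using hw, rfl⟩

theorem HasDensity.inter_thin
    (hthin : Tendsto (fun n : ℕ => ((T.ball n \ T.thin).ncard : ℝ) / ((T.ball n).ncard : ℝ)) atTop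
      (𝓝 0)) {S : Set T.Vertex} {A : ℝ} (hS : HasDensity S A) : HasDensity (S ∩ T.thin) A := by
  have hlow := Tendsto.sub hS hthin
  rw [sub_zero] at hlow
  refine tendsto_of_tendsto_of_tendsto_of_le_of_le hlow hS (fun n => ?_) (fun n => ?_)
  · dsimp only
    rw [← sub_div]
    gcongr
    rw [sub_le_iff_le_add]
    have hsub : S ∩ T.ball n ⊆ S ∩ T.thin ∩ T.ball n ∪ T.ball n \ T.thin := by
      rintro w ⟨hw, hwn⟩
      by_cases h : w ∈ T.thin
      · exact Or.inl ⟨⟨hw, h⟩, hwn⟩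
      · exact Or.inr ⟨hwn, h⟩
    have := (Set.ncard_le_ncard hsub (((finite_ball n).inter_of_right _).union
      (finite_ball n).sdiff)).trans (Set.ncard_union_le _ _)
    exact_mod_cast this
  · dsimp only
    gcongr
    · exact (finite_ball n).inter_of_right _
    · exact Set.inter_subset_left

theorem exists_independenceSet_of_log_lt_entropy (hT : T.Leafless) (hU : T.Unexpandable)
    (hthin : Tendsto (fun n : ℕ => ((T.ball n \ T.thin).ncard : ℝ) / ((T.ball n).ncard : ℝ)) atTop
      (𝓝 0)) {m : ℕ} (hm : 2 ≤ m) {X : Set (ℕ → Fin m)} (hX : IsShift X) (hXh : IsHereditary X)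
    (hne : X.Nonempty) (h : Real.log ((m : ℝ) - 1) < entropy X) :
    ∃ S : Set T.Vertex, IsIndependenceSet (T.treeShift X) S ∧ ∃ δ : ℝ, 0 < δ ∧ HasDensity S δ := by
  classical
  have : NeZero m := ⟨by omega⟩
  obtain ⟨x, hx, A, hA, hlim⟩ := hX.exists_pos_frequency hne hm ⊤ h
  -- Each path carries a copy of `x` beginning at its first vertex. Where `x` shows the largest
  -- letter, every label is dominated.
  let S : Set T.Vertex := {w | x (w.1.length - (hT.start w).1.length) = ⊤} ∩ T.thin
  refine ⟨S, fun u => ?_, A, hA,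
    (hasDensity_of_tendsto_count hT hU (fun i => x i = ⊤) hlim).inter_thin hthin⟩
  refine ⟨fun w => if hw : w ∈ S then u ⟨w, hw⟩ else 0,
    mem_treeShift_of_hereditary hT hXh hne (fun w hw => dif_neg fun h => hw h.2) fun s => ?_,
    fun g => dif_pos g.2⟩
  -- The path starts at level `|s|`, so `x` must be preceded by `|s|` letters to become a point of
  -- `X` indexed by levels.
  obtain ⟨y, hy, hyx⟩ := hx s.1.length
  refine ⟨y, hy, ?_⟩
  rintro w hw rfl
  by_cases hwS : w ∈ S
  · have h1 := hyx (w.1.length - (hT.start w).1.length)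
    rw [Nat.add_sub_cancel' (hT.length_start_le w), show x _ = ⊤ from hwS.1] at h1
    rw [h1]
    exact le_top
  · rw [dif_neg hwS]
    exact Fin.zero_le _

/-! ### Markov–Cayley trees -/

/-- In a leafless Markov–Cayley tree, branching below a vertex occurs within a bounded distance. -/
theorem markovCayley_exists_branching {d : ℕ} {M : Matrix (Fin d) (Fin d) (Fin 2)}
    (hT : (markovCayley M).Leafless) :
    ∃ K, ∀ v ∉ (markovCayley M).thin, ∃ w₁ w₂ : (markovCayley M).Vertex,
      v.1 <+: w₁.1 ∧ v.1 <+: w₂.1 ∧ w₁.1.length = v.1.length + K ∧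
        w₂.1.length = v.1.length + K ∧ w₁ ≠ w₂ := by
  classical
  -- Which words `e` may follow a vertex depends only on its last letter `o` (`none` at the root),
  -- so there are finitely many types and the branching distances have a maximum.
  let P : Option (Fin d) → List (Fin d) → Prop := fun o e =>
    e.IsChain (fun i j => M i j = 1) ∧ ∀ a ∈ o, ∀ b ∈ e.head?, M a b = 1
  have hP : ∀ v e, v ∈ (markovCayley M).carrier →
      (v ++ e ∈ (markovCayley M).carrier ↔ P v.getLast? e) := by
    intro v e hv
    show List.IsChain _ (v ++ e) ↔ _
    rw [List.isChain_append]
    exact ⟨fun h => ⟨h.2.1, h.2.2⟩, fun h => ⟨hv, h.1, h.2⟩⟩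
  have hk : ∀ o : Option (Fin d), ∃ k, (∃ e₁ e₂, P o e₁ ∧ P o e₂ ∧ e₁.length = e₂.length ∧
      e₁ ≠ e₂) → ∃ e₁ e₂, P o e₁ ∧ P o e₂ ∧ e₁.length = k ∧ e₂.length = k ∧ e₁ ≠ e₂ := by
    intro o
    by_cases h : ∃ e₁ e₂, P o e₁ ∧ P o e₂ ∧ e₁.length = e₂.length ∧ e₁ ≠ e₂
    · obtain ⟨e₁, e₂, h₁, h₂, hl, hne⟩ := h
      exact ⟨e₁.length, fun _ => ⟨e₁, e₂, h₁, h₂, rfl, hl.symm, hne⟩⟩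
    · exact ⟨0, fun h' => absurd h' h⟩
  choose k hk using hk
  refine ⟨Finset.univ.sup k, fun v hv => ?_⟩
  have hv' : ∃ e₁ e₂, P v.1.getLast? e₁ ∧ P v.1.getLast? e₂ ∧ e₁.length = e₂.length ∧
      e₁ ≠ e₂ := by
    simp only [thin, Set.mem_ofPred_eq, not_forall] at hv
    obtain ⟨⟨w₁, hw₁⟩, ⟨w₂, hw₂⟩, ⟨e₁, h₁⟩, ⟨e₂, h₂⟩, hl, hne⟩ := hv
    dsimp only at h₁ h₂ hl
    subst h₁ h₂
    refine ⟨e₁, e₂, (hP _ _ v.2).1 hw₁, (hP _ _ v.2).1 hw₂, by simpa using hl, ?_⟩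
    rintro rfl
    exact hne rfl
  obtain ⟨e₁, e₂, h₁, h₂, l₁, l₂, hne⟩ := hk _ hv'
  have hle : k v.1.getLast? ≤ Finset.univ.sup k := Finset.le_sup (Finset.mem_univ _)
  have c₁ := (hP v.1 e₁ v.2).2 h₁
  have c₂ := (hP v.1 e₂ v.2).2 h₂
  -- Both branches are prolonged to the common depth by chosen children; injectivity of `grow` keeps
  -- them distinct.
  refine ⟨hT.grow^[Finset.univ.sup k - k v.1.getLast?] ⟨_, c₁⟩,
    hT.grow^[Finset.univ.sup k - k v.1.getLast?] ⟨_, c₂⟩,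
    (List.prefix_append _ _).trans (hT.prefix_iterate_grow _ ⟨_, c₁⟩),
    (List.prefix_append _ _).trans (hT.prefix_iterate_grow _ ⟨_, c₂⟩), ?_, ?_, fun h => hne ?_⟩
  · rw [hT.length_iterate_grow, List.length_append, l₁]
    omega
  · rw [hT.length_iterate_grow, List.length_append, l₂]
    omega
  · have := congrArg Subtype.val (hT.grow_injective.iterate _ h)
    exact List.append_cancel_left this

theorem markovCayley_tendsto_ball_diff_thin {d : ℕ} {M : Matrix (Fin d) (Fin d) (Fin 2)}
    (hT : (markovCayley M).Leafless) (hU : (markovCayley M).Unexpandable) :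
    Tendsto (fun n : ℕ => (((markovCayley M).ball n \ (markovCayley M).thin).ncard : ℝ) /
      (((markovCayley M).ball n).ncard : ℝ)) atTop (𝓝 0) :=
  let ⟨_, hK⟩ := markovCayley_exists_branching hT
  hU.tendsto_ball_diff_thin hT hK

end TreeShift.WordTree

/-! ### Assembly of the theorem. -/

theorem theorem1 (m : ℕ) (hm : 2 ≤ m) :
    (∀ X : Set (ℕ → Fin m), IsShift X → IsHereditary X →
      ∀ (d : ℕ) (M : Matrix (Fin d) (Fin d) (Fin 2)),
        (markovCayley M).Leafless → (markovCayley M).Unexpandable →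
          -- (1) the entropies coincide
          treeEntropy ((markovCayley M).treeShift X) = entropy X ∧
          -- (2) over the alphabet `{0, 1}`
          (m = 2 → (0 < treeEntropy ((markovCayley M).treeShift X) ↔
            ∃ S : Set (markovCayley M).Vertex,
              IsIndependenceSet ((markovCayley M).treeShift X) S ∧
                ∃ δ : ℝ, 0 < δ ∧ HasDensity S δ)) ∧
          -- (2) over the alphabet `{0, …, m - 1}`
          ((∃ S : Set (markovCayley M).Vertex,
              IsIndependenceSet ((markovCayley M).treeShift X) S ∧ 0 < upperDensity S) →
            0 < treeEntropy ((markovCayley M).treeShift X)) ∧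
          (Real.log ((m : ℝ) - 1) < treeEntropy ((markovCayley M).treeShift X) →
            ∃ S : Set (markovCayley M).Vertex,
              IsIndependenceSet ((markovCayley M).treeShift X) S ∧
                ∃ δ : ℝ, 0 < δ ∧ HasDensity S δ)) ∧
    -- the last claim, for all shifts of entropy zero and all unexpandable trees
    (∀ X : Set (ℕ → Fin m), IsShift X → entropy X = 0 →
      ∀ (α : Type*) (T : WordTree α), T.Leafless → T.Unexpandable →
        ∀ S : Set T.Vertex, IsIndependenceSet (T.treeShift X) S → HasDensity S 0) := by
  have : NeZero m := ⟨by omega⟩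
  have hm' : (2 : ℝ) ≤ m := by exact_mod_cast hm
  refine ⟨fun X hX hXh d M hT hU => ?_, fun X _ h0 α T hT hU S hS =>
    hasDensity_zero_of_entropy_eq_zero hT hU hm h0 hS⟩
  have hthin := markovCayley_tendsto_ball_diff_thin hT hU
  have hent := treeEntropy_eq_entropy hT hU hthin hX hXh
  have hpos : (∃ S : Set (markovCayley M).Vertex,
      IsIndependenceSet ((markovCayley M).treeShift X) S ∧ 0 < upperDensity S) →
      0 < treeEntropy ((markovCayley M).treeShift X) := by
    rintro ⟨S, hS, hd⟩
    rw [hent]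
    exact (mul_pos hd (Real.log_pos (by linarith))).trans_le (upperDensity_mul_log_le hT hU hm hS)
  have hexists : Real.log ((m : ℝ) - 1) < treeEntropy ((markovCayley M).treeShift X) →
      ∃ S : Set (markovCayley M).Vertex,
        IsIndependenceSet ((markovCayley M).treeShift X) S ∧ ∃ δ : ℝ, 0 < δ ∧ HasDensity S δ := by
    intro h
    rw [hent] at h
    refine exists_independenceSet_of_log_lt_entropy hT hU hthin hm hX hXh ?_ h
    refine Set.nonempty_iff_ne_empty.2 ?_
    rintro rfl
    -- The empty shift is excluded because its entropy `0` does not exceed `log (m - 1) ≥ 0`.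
    have h0 : entropy (∅ : Set (ℕ → Fin m)) = 0 := by simp [entropy, blocks]
    rw [h0] at h
    exact h.not_ge (Real.log_nonneg (by linarith))
  refine ⟨hent, ?_, hpos, hexists⟩
  rintro rfl
  refine ⟨fun h => hexists ?_, fun ⟨S, hS, δ, hδ, hSδ⟩ => hpos ⟨S, hS, ?_⟩⟩
  -- For `m = 2` the threshold `log (m - 1)` is `0`.
  · norm_num
    exact h
  · rwa [hSδ.upperDensity_eq]
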